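/- Throughout, $n=2^s$ with an integer $s\ge 4$, and indices of vertices of an $n$-gon are taken modulo $n$. An $n$-gon with vertices $v_0,\dots,v_{n-1}$ is *small* if the largest distance between two of its vertices is $1$; its *diameter graph* joins exactly the pairs of vertices at distance $1$; $L(P)$ denotes the perimeter of $P$. The $O$-terms refer to $n=2^s\to\infty$. Put $u(\theta)=(\sin\theta,\cos\theta)$. *Mossinghoff's polygon.* $M_n$ is the convex equilateral small $n$-gon, symmetric in the vertical axis ($v_{n-i}$ is the mirror image of $v_i$), with vertices listed counterclockwise and $$v_{n-a}=\sum_{0\le j<a}\delta_j\ \ (0\le a\le n/4),\qquad v_{n/2-a}=v_{n-a}+u(2at)\ \ (0\le a<n/4),$$ where $\delta_j=u((2j+1)t)-u((2j+2)t)$ if $j=0$ or $j\equiv 1,2 \pmod 4$, $\delta_j=u(2jt)-u((2j+1)t)$ for all other $j$, and where $t\in(0,\pi/n)$ is such that all sides are equal. (Such a polygon exists for every $n=2^s$, $s\ge4$.) **Theorem.** For every $n=2^s$ with $s\ge 4$ there are a number $t_0(n)\in(0,\pi/n)$ and a convex equilateral small $n$-gon $B_n$ with vertices $v_0=(0,0),v_1,\dots,v_{n-1}$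 in counterclockwise order, $v_{n/2}=(0,1)$, symmetric in the vertical axis, such that: 1. the diameter graph of $B_n$ consists exactly of the edges $v_i v_{i+n/2}$ for even $i$ with $0\le i<n/2$, $i\ne n/4$; the edges $v_iv_{i+n/2-1}$, $v_iv_{i+n/2}$, $v_iv_{i+n/2+1}$ for $0<i<n/2$ with $i\equiv 3\pmod 4$; and the mirror images of these edges under $v_i\mapsto v_{n-i}$; 2. the angle at $v_0$ between $v_0v_{n/2-1}$ and $v_0v_{n/2}$ is $t_0(n)$, and $t=t_0(n)$ satisfies $$\bigl(2x+\sin((n/2-1)t)\bigr)^2+\cos^2((n/2-1)t)=4\sin^2(t/2),\qquad x=\sin t-\frac{(2\cos t-1)\bigl(\sin 2t+\sin((n/2-2)t)\bigr)}{2\cos 2t};$$ 3. $\displaystyle t_0(n)=\frac{\pi}{n}-\frac{\pi^4}{n^5}+\frac{\pi^5}{n^6}-\frac{11\pi^6}{6n^7}+\frac{35\pi^7}{12n^8}+O\!\left(\frac1{n^9}\right)$; 4. $\displaystyle 2n\sin\frac{\pi}{2n}-L(B_n)=\frac{\pi^4}{n^4}+O\!\left(\frac1{n^5}\right)$; 5.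 $\displaystyle L(B_n)-L(M_n)=\frac{2\pi^4}{n^4}+O\!\left(\frac1{n^5}\right)$. -/

import Mathlib

open Real Filter Asymptotics

noncomputable section

/-- The Euclidean plane; the coordinates of a point `p` are `p 0` (abscissa) and `p 1` (ordinate). -/
abbrev Plane : Type := EuclideanSpace ℝ (Fin 2)

/-- The reflection of the plane in the vertical axis. -/
def mirror (p : Plane) : Plane := !₂[-p 0, p 1]

/-- The unit vector that makes the clockwise angle `θ` with the upward vertical direction. -/
def unitDir (θ : ℝ) : Plane := !₂[sin θ, cos θ]

/-- The determinant with columns `b - a` and `c - a`: twice the signed area of the triangle `abc`,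
positive exactly when `a`, `b`, `c` make a strict left turn. -/
def orient (a b c : Plane) : ℝ :=
  (b 0 - a 0) * (c 1 - a 1) - (b 1 - a 1) * (c 0 - a 0)

namespace Polygon

/-- The vertex `v_k`, with indices taken modulo the number of vertices. -/
def vtx {n : ℕ} [NeZero n] (P : Polygon Plane n) (k : ℕ) : Plane :=
  P.vertices (Fin.ofNat n k)

/-- The perimeter: the sum of the lengths of the `n` sides. -/
def perimeter {n : ℕ} (P : Polygon Plane n) : ℝ :=
  ∑ i : Fin n, dist (P.vertices i) (P.vertices (finRotate n i))

/-- All sides have the same length. -/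
def IsEquilateral {n : ℕ} (P : Polygon Plane n) : Prop :=
  ∃ c : ℝ, ∀ i : Fin n, dist (P.vertices i) (P.vertices (finRotate n i)) = c

/-- A polygon is small if the largest distance between two of its vertices is one. -/
def IsSmall {n : ℕ} (P : Polygon Plane n) : Prop :=
  IsGreatest {d : ℝ | ∃ i j : Fin n, d = dist (P.vertices i) (P.vertices j)} 1

/-- `P` is a convex polygon with `n ≥ 3` genuine vertices, listed in counterclockwise order:
any three vertices, taken in the order of their indices, make a strict left turn. -/
def IsConvex {n : ℕ} (P : Polygon Plane n) : Prop :=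
  3 ≤ n ∧ ∀ i j k : Fin n, i < j → j < k →
    0 < orient (P.vertices i) (P.vertices j) (P.vertices k)

/-- A convex equilateral small polygon. -/
structure IsConvexEquilateralSmall {n : ℕ} (P : Polygon Plane n) : Prop where
  convex : P.IsConvex
  equilateral : P.IsEquilateral
  small : P.IsSmall

/-- The diameter graph of a small polygon: two vertices are joined exactly when they are at unit
distance. -/
def diameterGraph {n : ℕ} (P : Polygon Plane n) : SimpleGraph (Fin n) where
  Adj i j := dist (P.vertices i) (P.vertices j) = 1
  symm := ⟨fun i j h => by rw [dist_comm]; exact h⟩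
  loopless := ⟨fun i h => by simp at h⟩

end Polygon

/-- The edges of the prescribed diameter graph, up to reflection in the axis `v_0 v_{n/2}`
(`i` and `j` are indices modulo `n`):
* `v_i - v_{i+n/2}` for even `i` with `0 ≤ i < n/2`, `i ≠ n/4` (for `i = 0` this is the axis);
* `v_i - v_{i+n/2-1}`, `v_i - v_{i+n/2}`, `v_i - v_{i+n/2+1}` for `0 < i < n/2`, `i ≡ 3` mod `4`.

The edges `v_i - v_{i+n/2}` with `i ≡ 3` mod `4` and the axis are the pendant edges. The other edges
and their mirror images make up the path `v_0 - v_{n/2-1} - v_{n-2} - v_{n/2-2} - v_{n-3} - v_{n/2-4}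
- ⋯ - v_{3n/4+1} - v_{n/4}` of length `3n/8 - 1` and its mirror image. -/
def DiameterEdge (n i j : ℕ) : Prop :=
  (i % 2 = 0 ∧ i < n / 2 ∧ i ≠ n / 4 ∧ j = i + n / 2) ∨
  (i % 4 = 3 ∧ i < n / 2 ∧
    (j = i + n / 2 - 1 ∨ j = i + n / 2 ∨ j = (i + n / 2 + 1) % n))

/-- The prescribed diameter graph: the edges above and their mirror images under
`v_i ↦ v_{n-i}`. -/
def symmetricDiameterGraph (n : ℕ) : SimpleGraph (Fin n) :=
  SimpleGraph.fromRel fun i j : Fin n =>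
    DiameterEdge n i j ∨ DiameterEdge n ((n - i) % n) ((n - j) % n)

/-- The trigonometric equation for the side angle `t`: with `x` the abscissa of `v_{3n/4+1}`, it says
that the side from `v_{n/4-1}` to `v_{n/4}` has length `2 sin (t/2)`. -/
def SideAngleEquation (n : ℕ) (t : ℝ) : Prop :=
  let x := sin t - (2 * cos t - 1) * (sin (2 * t) + sin ((n / 2 - 2) * t)) / (2 * cos (2 * t))
  (2 * x + sin ((n / 2 - 1) * t)) ^ 2 + cos ((n / 2 - 1) * t) ^ 2 = 4 * sin (t / 2) ^ 2

/-- `B` is a convex equilateral small polygon with `v_0 = (0,0)` and `v_{n/2} = (0,1)`, symmetric in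
the vertical axis, with the prescribed diameter graph, whose angle at `v_0` between `v_{n/2-1}` and
`v_{n/2}` is `t`. -/
structure IsBPolygon {n : ℕ} [NeZero n] (t : ℝ) (B : Polygon Plane n) : Prop where
  isConvexEquilateralSmall : B.IsConvexEquilateralSmall
  vtx_zero : B.vtx 0 = 0
  vtx_half : B.vtx (n / 2) = !₂[0, 1]
  symmetric : ∀ i ≤ n, B.vtx (n - i) = mirror (B.vtx i)
  diameterGraph_eq : B.diameterGraph = symmetricDiameterGraph n
  angle_eq : EuclideanGeometry.angle (B.vtx (n / 2 - 1)) (B.vtx 0) (B.vtx (n / 2)) = t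

/-! ### Mossinghoff's polygon

For `k = 0, 1, …, n/2 - 1` the polygon has exactly one diameter of direction `unitDir (k * t)`,
leading from one of the vertices `v_0, v_{n-1}, v_{n-2}, …` up to one of the vertices
`v_{n/2}, v_{n/2-1}, v_{n/2-2}, …`. Consecutive diameters share a vertex. The diameters with
`k = 0` and with `k ∈ {6, 10, 14, …, n/2 - 2}` are pendant; the others are in order the edges of the
half-path that starts at `v_0` (directions `1, 2, 3, 4, 5, 7, 8, 9, 11, 12, 13, …, n/2 - 1`).
The mirror images of all these diameters are diameters, too. -/

/-- The vector from `v_{n-j}` to `v_{n-j-1}`. For `j = 0` and for `j ≡ 1, 2` mod `4` the diameter of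
direction `(2j+1) t` joins `v_{n-j}` to `v_{n/2-j-1}`, for the other `j` it joins `v_{n-j-1}` to
`v_{n/2-j}`. The diameters of direction `2jt` join `v_{n-j}` to `v_{n/2-j}`. -/
def mossinghoffStep (t : ℝ) (j : ℕ) : Plane :=
  if j = 0 ∨ j % 4 = 1 ∨ j % 4 = 2 then
    unitDir ((2 * j + 1) * t) - unitDir ((2 * j + 2) * t)
  else
    unitDir (2 * j * t) - unitDir ((2 * j + 1) * t)

/-- The vertex `v_{n-a}`, for `0 ≤ a ≤ n/4`. -/
def mossinghoffLow (t : ℝ) (a : ℕ) : Plane := ∑ j ∈ Finset.range a, mossinghoffStep t j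

/-- The vertex `v_{n/2-a}`, for `0 ≤ a < n/4`. -/
def mossinghoffHigh (t : ℝ) (a : ℕ) : Plane := mossinghoffLow t a + unitDir (2 * a * t)

/-- The vertex `v_i`, for `0 ≤ i < n`. -/
def mossinghoffVertex (n : ℕ) (t : ℝ) (i : ℕ) : Plane :=
  if i ≤ n / 4 then mirror (mossinghoffLow t i)
  else if i ≤ n / 2 then mossinghoffHigh t (n / 2 - i)
  else if i < 3 * n / 4 then mirror (mossinghoffHigh t (i - n / 2))
  else mossinghoffLow t (n - i)

/-- `M` is Mossinghoff's convex equilateral small polygon: it has the vertices above, the angle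
`t` in `(0, π/n)` being determined by the requirement that all sides are equal (all sides except
`v_{n/4} v_{n/4+1}` and its mirror image have length `2 sin (t/2)` for every `t`). -/
def IsMossinghoffPolygon {n : ℕ} (M : Polygon Plane n) : Prop :=
  M.IsConvexEquilateralSmall ∧
    ∃ t ∈ Set.Ioo 0 (π / n), ∀ i : Fin n, M.vertices i = mossinghoffVertex n t i

end

/-! Put h = n/4. Both polygons carry diameters in the directions 0, t, 2t, …, (n/2-1)t, and a
pattern σ decides, for each odd multiple of t, which two vertices its diameter joins. Whatever σ is,
all sides are then chords of a unit circle of length 2 sin(t/2), except one side v_k v_{k+1} and its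
mirror image. Requiring the same length there is a single equation for t (`IsPatternAngle`). The
polygons B and M come from the patterns `BStep` (k = h-1) and `MStep` (k = h). Only 16 ∣ n is used
before the final theorem.

Geometry. The side directions of the right half increase within (0, π), which gives convexity. At a
farthest pair of vertices, the difference vector has positive product with the side leaving an end
and negative product with the side arriving there. As a function of the direction this product is a
sinusoid, which cannot change sign twice within a half period. Hence the outgoing directions at the
two ends, read on the right half, add up to more than π and the incoming ones to less
(`ConvexChain.pi_lt_add`, `ConvexChain.add_lt_pi`). For the explicit directions this leaves only the
prescribed unit pairs and two horizontal pairs, which are shorter than 1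
(`UnitChain.unitPair_of_max_aux`). So smallness and the exact diameter graph follow from one
argument.

Existence. At t = π/(n+1) the exceptional side is too long because of its vertical extent alone. At
t = π/n it is too short, by the closed form of the abscissa of its lower end (`patternLow_BStep`,
`patternLow_MStep`). The intermediate value theorem gives t (`exists_isPatternAngle`).

Asymptotics. With the defect η = π/2 - nt/2 the equation reads 2(cos t - cos(t+η)) = E(2(1 -
cos(t+η)) - E), where E ≈ t³ for B and E ≈ 3t³ for M (`defect_B`, `defect_M`). The left side is
about 2tη and the last factor about t², so η ≈ t⁴/2 for B and η ≈ 3t⁴/2 for M. Since t = π/n - 2η/n,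
the perimeter 2n sin(t/2) falls short of 2n sin(π/2n) by about 2η, that is π⁴/n⁴ and 3π⁴/n⁴
(`perimeter_expansion`). Feeding the estimate back into the equation gives further coefficients for
B (`expansion_B`). -/

/-! ### The plane -/

lemma plane_dist_sq (a b : Plane) : dist a b ^ 2 = (b 0 - a 0) ^ 2 + (b 1 - a 1) ^ 2 := by
  rw [EuclideanSpace.dist_eq, Real.sq_sqrt (by positivity)]
  simp [Fin.sum_univ_two, Real.dist_eq, sq_abs]
  ring

@[simp] lemma mirror_fst (p : Plane) : mirror p 0 = -p 0 := by simp [mirror]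

@[simp] lemma mirror_snd (p : Plane) : mirror p 1 = p 1 := by simp [mirror]

@[simp] lemma unitDir_fst (θ : ℝ) : unitDir θ 0 = sin θ := by simp [unitDir]

@[simp] lemma unitDir_snd (θ : ℝ) : unitDir θ 1 = cos θ := by simp [unitDir]

lemma plane_ext {a b : Plane} (h0 : a 0 = b 0) (h1 : a 1 = b 1) : a = b := by
  ext i; fin_cases i <;> assumption

@[simp] lemma mirror_mirror (p : Plane) : mirror (mirror p) = p :=
  plane_ext (by simp) (by simp)

lemma dist_eq_of_sq {a b : Plane} {c : ℝ} (hc : 0 ≤ c)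
    (h : (b 0 - a 0) ^ 2 + (b 1 - a 1) ^ 2 = c ^ 2) : dist a b = c := by
  rw [← plane_dist_sq] at h
  exact (pow_left_inj₀ dist_nonneg hc two_ne_zero).1 h

@[simp] lemma dist_mirror (a b : Plane) : dist (mirror a) (mirror b) = dist a b := by
  apply dist_eq_of_sq dist_nonneg
  rw [plane_dist_sq]
  simp; ring

lemma orient_mirror (a b c : Plane) :
    orient (mirror a) (mirror b) (mirror c) = -orient a b c := by
  simp [orient]; ring

lemma orient_rotate (a b c : Plane) : orient b c a = orient a b c := by
  simp [orient]; ring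

lemma orient_swap (a b c : Plane) : orient a c b = -orient a b c := by
  simp [orient]; ring

/-- Around the point `o`, the left-turn relation is transitive on the open half plane to the left of
the ray from `o` to `r`. -/
lemma orient_trans {o r a b c : Plane} (ha : 0 ≤ orient o r a) (hb : 0 < orient o r b)
    (hc : 0 < orient o r c) (hab : 0 < orient o a b) (hbc : 0 < orient o b c) :
    0 < orient o a c := by
  -- The three-term Plücker relation for the four vectors from `o` to `r`, `a`, `b`, `c`.
  have key : orient o r b * orient o a c
      = orient o r a * orient o b c + orient o r c * orient o a b := by
    simp only [orient]; ring
  have : 0 < orient o r b * orient o a c := by rw [key]; positivity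
  exact pos_of_mul_pos_right this hb.le

/-- If `b` is at least as far from `a` as from `c`, then `c` lies strictly on the side of `b` of the
line through `a` perpendicular to `ab`. -/
lemma inner_pos_of_dist_le {a b c : Plane} (h : dist c b ≤ dist a b) (hca : c ≠ a) :
    0 < (c 0 - a 0) * (b 0 - a 0) + (c 1 - a 1) * (b 1 - a 1) := by
  have h2 : dist c b ^ 2 ≤ dist a b ^ 2 := by gcongr
  have h3 : 0 < dist a c ^ 2 := by
    have := dist_pos.2 hca.symm
    positivity
  rw [plane_dist_sq] at *
  rw [plane_dist_sq] at h2
  nlinarith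

/-- A combination of sine and cosine cannot change its sign twice within a half period. -/
lemma sinusoid_neg {a b α β γ : ℝ} (h1 : α < β) (h2 : β ≤ γ) (h3 : γ - α < π)
    (hα : cos α * a + sin α * b < 0) (hγ : cos γ * a + sin γ * b < 0) :
    cos β * a + sin β * b < 0 := by
  -- The value at `β` is interpolated from the values at `α` and `γ`; the weights are nonnegative
  -- because `γ - α < π`.
  have key : sin (γ - α) * (cos β * a + sin β * b) =
      sin (γ - β) * (cos α * a + sin α * b) + sin (β - α) * (cos γ * a + sin γ * b) := by
    simp only [sin_sub]; ring
  have s1 : 0 < sin (γ - α) := sin_pos_of_pos_of_lt_pi (by linarith) h3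
  have s2 : 0 ≤ sin (γ - β) := sin_nonneg_of_nonneg_of_le_pi (by linarith) (by linarith)
  have s3 : 0 < sin (β - α) := sin_pos_of_pos_of_lt_pi (by linarith) (by linarith)
  by_contra hcon
  push Not at hcon
  have := mul_nonneg s1.le hcon
  have e1 := mul_nonneg s2 (neg_nonneg.2 hα.le)
  have e2 := mul_pos s3 (neg_pos.2 hγ)
  nlinarith

lemma sinusoid_pos {a b α β γ : ℝ} (h1 : α < β) (h2 : β ≤ γ) (h3 : γ - α < π)
    (hα : 0 < cos α * a + sin α * b) (hγ : 0 < cos γ * a + sin γ * b) :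
    0 < cos β * a + sin β * b := by
  have := sinusoid_neg (a := -a) (b := -b) h1 h2 h3 (by linarith) (by linarith)
  linarith

/-! ### Symmetric closed chains -/

/-- A closed equilateral chain `v 0, …, v (2 m) = v 0`, symmetric in the vertical axis through
`v 0`, whose right half has the directions `φ 0 < φ 1 < ⋯ < φ (m - 1)` in `(0, π)`. -/
structure ConvexChain (m : ℕ) (ℓ : ℝ) (φ : ℕ → ℝ) (v : ℕ → Plane) : Prop where
  len_pos : 0 < ℓ
  two_le : 2 ≤ m
  fst_zero : v 0 0 = 0
  symm : ∀ i ≤ 2 * m, v (2 * m - i) = mirror (v i)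
  fst_succ : ∀ i < m, v (i + 1) 0 = v i 0 + ℓ * cos (φ i)
  snd_succ : ∀ i < m, v (i + 1) 1 = v i 1 + ℓ * sin (φ i)
  strictMono : ∀ i j, i < j → j < m → φ i < φ j
  pos : ∀ i < m, 0 < φ i
  lt_pi : ∀ i < m, φ i < π

namespace ConvexChain

variable {m : ℕ} {ℓ : ℝ} {φ : ℕ → ℝ} {v : ℕ → Plane}

lemma mono (C : ConvexChain m ℓ φ v) {i j : ℕ} (hij : i ≤ j) (hj : j < m) : φ i ≤ φ j := by
  rcases hij.eq_or_lt with rfl | h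
  · exact le_rfl
  · exact (C.strictMono i j h hj).le

lemma fst_mid (C : ConvexChain m ℓ φ v) : v m 0 = 0 := by
  have := C.symm m (by omega)
  rw [show 2 * m - m = m by omega] at this
  have h := congrArg (fun p : Plane => p 0) this
  simp at h
  linarith

lemma closed (C : ConvexChain m ℓ φ v) : v (2 * m) = v 0 := by
  have := C.symm 0 (by omega)
  rw [Nat.sub_zero] at this
  rw [this]
  exact plane_ext (by simp [C.fst_zero]) (by simp)

lemma mirror_eq (C : ConvexChain m ℓ φ v) {i : ℕ} (hi : i ≤ 2 * m) :
    mirror (v (2 * m - i)) = v i := by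
  rw [C.symm i hi, mirror_mirror]

lemma dist_succ (C : ConvexChain m ℓ φ v) {i : ℕ} (hi : i < 2 * m) :
    dist (v i) (v (i + 1)) = ℓ := by
  have key : ∀ i < m, dist (v i) (v (i + 1)) = ℓ := by
    intro i hi
    apply dist_eq_of_sq C.len_pos.le
    rw [C.fst_succ i hi, C.snd_succ i hi]
    linear_combination ℓ ^ 2 * sin_sq_add_cos_sq (φ i)
  rcases lt_or_ge i m with h | h
  · exact key i h
  · rw [← C.mirror_eq (i := i) (by omega), ← C.mirror_eq (i := i + 1) (by omega), dist_mirror,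
      dist_comm]
    have := key (2 * m - (i + 1)) (by omega)
    rwa [show 2 * m - (i + 1) + 1 = 2 * m - i by omega] at this

/-- The moment `cos (φ j) * y - sin (φ j) * x` increases strictly along the right half after the
edge `j`. -/
lemma moment_lt_of_lt (C : ConvexChain m ℓ φ v) {j k : ℕ} (hjk : j + 1 < k) (hk : k ≤ m) :
    cos (φ j) * v j 1 - sin (φ j) * v j 0 < cos (φ j) * v k 1 - sin (φ j) * v k 0 := by
  have base : cos (φ j) * v (j + 1) 1 - sin (φ j) * v (j + 1) 0
      = cos (φ j) * v j 1 - sin (φ j) * v j 0 := by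
    rw [C.fst_succ j (by omega), C.snd_succ j (by omega)]; ring
  have step : ∀ p, j < p → p < m → cos (φ j) * v p 1 - sin (φ j) * v p 0
      < cos (φ j) * v (p + 1) 1 - sin (φ j) * v (p + 1) 0 := by
    intro p hp hpm
    have h1 := C.strictMono j p hp hpm
    have : 0 < sin (φ p - φ j) := sin_pos_of_pos_of_lt_pi (by linarith)
      (by linarith [C.pos j (by omega), C.lt_pi p hpm])
    rw [sin_sub] at this
    rw [C.fst_succ p hpm, C.snd_succ p hpm]
    nlinarith [mul_pos C.len_pos this]
  rw [← base]
  induction k, hjk using Nat.le_induction with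
  | base => exact step _ (by omega) (by omega)
  | succ p hp ih => exact (ih (by omega)).trans (step p (by omega) (by omega))

lemma moment_lt_of_gt (C : ConvexChain m ℓ φ v) {j k : ℕ} (hkj : k < j) (hj : j < m) :
    cos (φ j) * v j 1 - sin (φ j) * v j 0 < cos (φ j) * v k 1 - sin (φ j) * v k 0 := by
  have step : ∀ p, p < j → cos (φ j) * v (p + 1) 1 - sin (φ j) * v (p + 1) 0
      < cos (φ j) * v p 1 - sin (φ j) * v p 0 := by
    intro p hp
    have h1 := C.strictMono p j hp hj
    have : 0 < sin (φ j - φ p) := sin_pos_of_pos_of_lt_pi (by linarith)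
      (by linarith [C.pos p (by omega), C.lt_pi j hj])
    rw [sin_sub] at this
    rw [C.fst_succ p (by omega), C.snd_succ p (by omega)]
    nlinarith [mul_pos C.len_pos this]
  obtain ⟨d, rfl⟩ : ∃ d, j = k + 1 + d := ⟨j - k - 1, by omega⟩
  have key : ∀ d', d' ≤ d → cos (φ (k + 1 + d)) * v (k + 1 + d') 1
      - sin (φ (k + 1 + d)) * v (k + 1 + d') 0
      < cos (φ (k + 1 + d)) * v k 1 - sin (φ (k + 1 + d)) * v k 0 := by
    intro d' hd'
    induction d' with
    | zero => exact step k (by omega)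
    | succ e ih => exact (step (k + 1 + e) (by omega)).trans (ih (by omega))
  exact key d le_rfl

/-- The interior vertices of the right half lie strictly to the right of the axis. -/
lemma fst_pos (C : ConvexChain m ℓ φ v) {i : ℕ} (hi : 0 < i) (him : i < m) : 0 < v i 0 := by
  -- If `φ i ≤ π / 2`, all sides before `v i` lead to the right, away from the axis. Otherwise all
  -- sides from `v i` on lead to the left, and they end on the axis at `v m`.
  rcases le_or_gt (φ i) (π / 2) with h | h
  · have key : ∀ p, p < i → 0 < v (p + 1) 0 := by
      intro p
      induction p with
      | zero =>
        intro hp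
        rw [C.fst_succ 0 (by omega), C.fst_zero, zero_add]
        exact mul_pos C.len_pos (cos_pos_of_mem_Ioo
          ⟨by linarith [C.pos 0 (by omega), pi_pos], by linarith [C.strictMono 0 i hi him]⟩)
      | succ p ih =>
        intro hp
        rw [C.fst_succ (p + 1) (by omega)]
        have := mul_pos C.len_pos (cos_pos_of_mem_Ioo (x := φ (p + 1))
          ⟨by linarith [C.pos (p + 1) (by omega), pi_pos],
            by linarith [C.strictMono (p + 1) i hp him]⟩)
        linarith [ih (by omega)]
    have := key (i - 1) (by omega)
    rwa [show i - 1 + 1 = i by omega] at this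
  · have step : ∀ p, i ≤ p → p < m → v (p + 1) 0 < v p 0 := by
      intro p hip hp
      rw [C.fst_succ p hp]
      have : cos (φ p) < 0 := cos_neg_of_pi_div_two_lt_of_lt
        (by linarith [C.mono hip hp]) (by linarith [C.lt_pi p hp, pi_pos])
      nlinarith [C.len_pos]
    have key : ∀ k, i + 1 ≤ k → k ≤ m → v k 0 < v i 0 := by
      intro k hk
      induction k, hk using Nat.le_induction with
      | base => intro h; exact step i le_rfl (by omega)
      | succ p hp ih => intro h; exact (step p (by omega) (by omega)).trans (ih (by omega))
    have := key m (by omega) le_rfl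
    rwa [C.fst_mid] at this

lemma orient_edge_eq (C : ConvexChain m ℓ φ v) {j : ℕ} (hj : j < m) (p : Plane) :
    orient (v j) (v (j + 1)) p = ℓ * ((cos (φ j) * p 1 - sin (φ j) * p 0)
      - (cos (φ j) * v j 1 - sin (φ j) * v j 0)) := by
  rw [orient, C.fst_succ j hj, C.snd_succ j hj]; ring

lemma orient_edge_right (C : ConvexChain m ℓ φ v) {j q : ℕ} (hj : j < m) (hq : q ≤ m)
    (h1 : q ≠ j) (h2 : q ≠ j + 1) : 0 < orient (v j) (v (j + 1)) (v q) := by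
  rw [C.orient_edge_eq hj]
  apply mul_pos C.len_pos
  rcases lt_or_gt_of_ne h1 with h | h
  · linarith [C.moment_lt_of_gt h hj]
  · linarith [C.moment_lt_of_lt (show j + 1 < q by omega) hq]

lemma orient_edge_pos_of_lt (C : ConvexChain m ℓ φ v) {j q : ℕ} (hj : j < m) (hq : q < 2 * m)
    (h1 : q ≠ j) (h2 : q ≠ j + 1) : 0 < orient (v j) (v (j + 1)) (v q) := by
  rcases le_or_gt q m with h | h
  · exact C.orient_edge_right hj h h1 h2
  · obtain ⟨r, rfl⟩ : ∃ r, q = 2 * m - r := ⟨2 * m - q, by omega⟩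
    have hx := C.fst_pos (i := r) (by omega) (by omega)
    have hs : 0 < sin (φ j) := sin_pos_of_pos_of_lt_pi (C.pos j hj) (C.lt_pi j hj)
    have h0 : 0 ≤ orient (v j) (v (j + 1)) (v r) := by
      by_cases e1 : r = j
      · subst e1; simp [orient]
      by_cases e2 : r = j + 1
      · subst e2; apply le_of_eq; simp [orient]; ring
      exact (C.orient_edge_right hj (by omega) e1 e2).le
    -- Reflecting `v r` raises its moment by twice `sin (φ j) * v r 0`, so a vertex weakly to the
    -- left of the edge becomes strictly so.
    rw [C.symm r (by omega), C.orient_edge_eq hj, mirror_fst, mirror_snd]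
    rw [C.orient_edge_eq hj] at h0
    have := mul_pos C.len_pos (mul_pos hs hx)
    nlinarith

/-- Every vertex off the edge `j` lies strictly to the left of it. -/
lemma orient_edge_pos (C : ConvexChain m ℓ φ v) {j q : ℕ} (hj : j < 2 * m) (hq : q < 2 * m)
    (h1 : q ≠ j) (h2 : q ≠ j + 1) (h3 : j + 1 = 2 * m → q ≠ 0) :
    0 < orient (v j) (v (j + 1)) (v q) := by
  rcases lt_or_ge j m with h | h
  · exact C.orient_edge_pos_of_lt h hq h1 h2
  · have e1 : v j = mirror (v (2 * m - (j + 1) + 1)) := by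
      rw [show 2 * m - (j + 1) + 1 = 2 * m - j by omega, C.mirror_eq (by omega)]
    have e2 : v (j + 1) = mirror (v (2 * m - (j + 1))) := by rw [C.mirror_eq (by omega)]
    -- An edge of the left half is the mirror image of edge `2 * m - (j + 1)`, traversed backwards;
    -- the reversal and the reflection each flip the sign. The vertex `q = 0` is treated apart,
    -- since `2 * m - 0` is outside the index range.
    have key : ∀ r < 2 * m, r ≠ 2 * m - (j + 1) → r ≠ 2 * m - j → v q = mirror (v r) →
        0 < orient (v j) (v (j + 1)) (v q) := by
      intro r hr hr1 hr2 e
      rw [e1, e2, e, orient_mirror]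
      have := C.orient_edge_pos_of_lt (j := 2 * m - (j + 1)) (q := r) (by omega) hr hr1 (by omega)
      rwa [← orient_swap, orient_rotate]
    rcases Nat.eq_zero_or_pos q with h0 | h0
    · subst h0
      refine key 0 (by omega) (by omega) (by omega) ?_
      rw [← C.symm 0 (by omega), Nat.sub_zero, C.closed]
    · exact key (2 * m - q) (by omega) (by omega) (by omega) (by rw [C.mirror_eq (by omega)])

/-- Seen from `v i`, all later vertices lie to the left of the edge leaving `v i`, and consecutive
ones turn left because `v i` lies to the left of the edge joining them. `orient_trans` chains these
turns from `j` up to `k`. -/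
theorem orient_pos (C : ConvexChain m ℓ φ v) {i j k : ℕ} (hij : i < j) (hjk : j < k)
    (hk : k < 2 * m) : 0 < orient (v i) (v j) (v k) := by
  have hr : ∀ q, i + 1 < q → q < 2 * m → 0 < orient (v i) (v (i + 1)) (v q) :=
    fun q h1 h2 => C.orient_edge_pos (by omega) h2 (by omega) (by omega) (by omega)
  have hr' : ∀ q, i + 1 ≤ q → q < 2 * m → 0 ≤ orient (v i) (v (i + 1)) (v q) := by
    intro q h1 h2
    rcases h1.eq_or_lt with rfl | h
    · apply le_of_eq; simp [orient]; ring
    · exact (hr q h h2).le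
  have hs : ∀ q, i < q → q + 1 < 2 * m → 0 < orient (v i) (v q) (v (q + 1)) := by
    intro q h1 h2
    rw [← orient_rotate]
    exact C.orient_edge_pos (by omega) (by omega) (by omega) (by omega) (by omega)
  induction k, hjk using Nat.le_induction with
  | base => exact hs j hij hk
  | succ p hp ih =>
    exact orient_trans (hr' j hij (by omega)) (hr p (by omega) (by omega)) (hr _ (by omega) hk)
      (ih (by omega)) (hs p (by omega) hk)

/-! Pairs of vertices at the maximal distance. -/

lemma edge_ne (C : ConvexChain m ℓ φ v) {i : ℕ} (hi : i < m) : v (i + 1) ≠ v i := by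
  rw [← dist_pos, dist_comm, C.dist_succ (by omega)]
  exact C.len_pos

/-- The right half leaves a farthest point towards its partner. -/
lemma forward_pos (C : ConvexChain m ℓ φ v) {i : ℕ} {b : Plane} (hi : i < m)
    (h : dist (v (i + 1)) b ≤ dist (v i) b) :
    0 < cos (φ i) * (b 0 - v i 0) + sin (φ i) * (b 1 - v i 1) := by
  have := inner_pos_of_dist_le h (C.edge_ne hi)
  rw [C.fst_succ i hi, C.snd_succ i hi] at this
  refine pos_of_mul_pos_right (a := ℓ) ?_ C.len_pos.le
  linarith

lemma backward_neg (C : ConvexChain m ℓ φ v) {i : ℕ} {b : Plane} (hi : i < m)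
    (h : dist (v i) b ≤ dist (v (i + 1)) b) :
    cos (φ i) * (b 0 - v (i + 1) 0) + sin (φ i) * (b 1 - v (i + 1) 1) < 0 := by
  have := inner_pos_of_dist_le h (C.edge_ne hi).symm
  rw [C.fst_succ i hi, C.snd_succ i hi] at *
  refine neg_of_neg_pos (pos_of_mul_pos_right (a := ℓ) ?_ C.len_pos.le)
  linarith

/-- If `v i` and the mirror image of `v j` are at maximal distance, their outgoing directions turn
past each other. -/
lemma pi_lt_add (C : ConvexChain m ℓ φ v) {i j : ℕ} (hi : i < m) (hj : j < m)
    (hmax : ∀ p ≤ m, ∀ q ≤ m, dist (v p) (mirror (v q)) ≤ dist (v i) (mirror (v j)))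
    (hne : 0 < i ∨ 0 < j) : π < φ i + φ j := by
  have hd : ∀ p q, dist (v p) (mirror (v q)) = dist (v q) (mirror (v p)) := by
    intro p q
    rw [← dist_mirror, mirror_mirror, dist_comm]
  by_contra hcon
  push Not at hcon
  have f1 := C.forward_pos hi (hmax (i + 1) (by omega) j (by omega))
  have f2 := C.forward_pos hj (b := mirror (v i))
    (by rw [← hd, hd j]; exact hmax i (by omega) (j + 1) (by omega))
  simp only [mirror_fst, mirror_snd] at f1 f2
  -- Let d be the vector from `v i` to the mirror image of `v j`, and f(θ) its product with the
  -- direction θ. Then f is positive at `φ i` by `f1`, negative at `π - φ j` by `f2`, and negative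
  -- at the direction of the side arriving at `v i`. With `φ i ≤ π - φ j` these would be two sign
  -- changes within a half period. If `i = 0` there is no arriving side, and the roles of `i` and
  -- `j` are exchanged.
  rcases hne with h | h
  · obtain ⟨i, rfl⟩ : ∃ i', i = i' + 1 := ⟨i - 1, by omega⟩
    have f3 := C.backward_neg (b := mirror (v j)) (by omega) (hmax i (by omega) j (by omega))
    simp only [mirror_fst, mirror_snd] at f3
    have := sinusoid_neg (α := φ i) (β := φ (i + 1)) (γ := π - φ j)
      (a := -v j 0 - v (i + 1) 0) (b := v j 1 - v (i + 1) 1) (C.strictMono _ _ (by omega) hi)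
      (by linarith) (by linarith [C.pos i (by omega), C.pos j hj]) f3
      (by rw [cos_pi_sub, sin_pi_sub]; linarith)
    linarith
  · obtain ⟨j, rfl⟩ : ∃ j', j = j' + 1 := ⟨j - 1, by omega⟩
    have f3 := C.backward_neg (b := mirror (v i)) (by omega : j < m)
      (by rw [← hd, hd (j + 1)]; exact hmax i (by omega) j (by omega))
    simp only [mirror_fst, mirror_snd] at f3
    have := sinusoid_neg (α := φ j) (β := φ (j + 1)) (γ := π - φ i)
      (a := -v i 0 - v (j + 1) 0) (b := v i 1 - v (j + 1) 1) (C.strictMono _ _ (by omega) hj)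
      (by linarith) (by linarith [C.pos j (by omega), C.pos i hi]) f3
      (by rw [cos_pi_sub, sin_pi_sub]; linarith)
    linarith

/-- The counterpart of `pi_lt_add` for the sides arriving at the two vertices, with the same
sinusoid and all signs reversed. -/
lemma add_lt_pi (C : ConvexChain m ℓ φ v) {i j : ℕ} (hi : i < m) (hj : j < m)
    (hmax : ∀ p ≤ m, ∀ q ≤ m, dist (v p) (mirror (v q)) ≤ dist (v (i + 1)) (mirror (v (j + 1))))
    (hne : i + 1 < m ∨ j + 1 < m) : φ i + φ j < π := by
  have hd : ∀ p q, dist (v p) (mirror (v q)) = dist (v q) (mirror (v p)) := by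
    intro p q
    rw [← dist_mirror, mirror_mirror, dist_comm]
  by_contra hcon
  push Not at hcon
  have f1 := C.backward_neg hi (hmax i (by omega) (j + 1) (by omega))
  have f2 := C.backward_neg hj (b := mirror (v (i + 1)))
    (by rw [← hd, hd (j + 1)]; exact hmax (i + 1) (by omega) j (by omega))
  simp only [mirror_fst, mirror_snd] at f1 f2
  rcases hne with h | h
  · have f3 := C.forward_pos (b := mirror (v (j + 1))) h
      (hmax (i + 1 + 1) (by omega) (j + 1) (by omega))
    simp only [mirror_fst, mirror_snd] at f3
    have hlt := C.strictMono i (i + 1) (by omega) h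
    -- `sinusoid_pos` needs strict inequality at its left end. In the case of equality `f1` and `f2`
    -- give opposite signs at the same direction.
    rcases hcon.eq_or_lt with e | e
    · have e' : φ j = π - φ i := by linarith
      rw [e', cos_pi_sub, sin_pi_sub] at f2
      linarith
    have := sinusoid_pos (α := π - φ j) (β := φ i) (γ := φ (i + 1))
      (a := -v (j + 1) 0 - v (i + 1) 0) (b := v (j + 1) 1 - v (i + 1) 1) (by linarith)
      hlt.le (by linarith [C.lt_pi (i + 1) h, C.lt_pi j hj])
      (by rw [cos_pi_sub, sin_pi_sub]; linarith) f3
    linarith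
  · have f3 := C.forward_pos (b := mirror (v (i + 1))) h
      (by rw [← hd, hd (j + 1)]; exact hmax (i + 1) (by omega) (j + 1 + 1) (by omega))
    simp only [mirror_fst, mirror_snd] at f3
    have hlt := C.strictMono j (j + 1) (by omega) h
    rcases hcon.eq_or_lt with e | e
    · have e' : φ j = π - φ i := by linarith
      rw [e', cos_pi_sub, sin_pi_sub] at f2
      linarith
    have := sinusoid_pos (α := π - φ i) (β := φ j) (γ := φ (j + 1))
      (a := -v (i + 1) 0 - v (j + 1) 0) (b := v (i + 1) 1 - v (j + 1) 1) (by linarith)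
      hlt.le (by linarith [C.lt_pi (j + 1) h, C.lt_pi i hi])
      (by rw [cos_pi_sub, sin_pi_sub]; linarith) f3
    linarith

/-- Two vertices strictly inside the right half are never at maximal distance. -/
lemma not_max_same_side (C : ConvexChain m ℓ φ v) {i j : ℕ} (hi : 0 < i) (hij : i < j) (hj : j < m)
    (hmax : ∀ p ≤ m, ∀ q ≤ m, dist (v p) (v q) ≤ dist (v i) (v j)) : False := by
  have f1 := C.forward_pos (b := v j) (i := i) (by omega) (hmax (i + 1) (by omega) j (by omega))
  have f2 := C.forward_pos (b := v i) hj
    (by rw [dist_comm, dist_comm (v j)]; exact hmax i (by omega) (j + 1) (by omega))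
  obtain ⟨i, rfl⟩ : ∃ i', i = i' + 1 := ⟨i - 1, by omega⟩
  have f3 := C.backward_neg (b := v j) (i := i) (by omega) (hmax i (by omega) j (by omega))
  -- The product of `v j - v i` with a direction is negative on the side arriving at `v i`, positive
  -- on the side leaving it, and negative on the side leaving `v j`. These three directions
  -- increase.
  have := sinusoid_neg (α := φ i) (β := φ (i + 1)) (γ := φ j)
    (a := v j 0 - v (i + 1) 0) (b := v j 1 - v (i + 1) 1) (C.strictMono _ _ (by omega) (by omega))
    (C.mono hij.le hj) (by linarith [C.lt_pi j hj, C.pos i (by omega)]) f3 (by linarith)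
  linarith

end ConvexChain

/-! ### Chains in which all but one antipodal pair are at unit distance -/

/-- The antipodal pairs at unit distance, up to symmetry: `(i, j)` stands for the vertex `v i` and
the mirror image of the vertex `v j`. -/
def UnitPair (h : ℕ) (σ : ℕ → Prop) (i j : ℕ) : Prop :=
  (i < h ∧ i + j = 2 * h) ∨ (i < h ∧ σ i ∧ i + j + 1 = 2 * h) ∨
    ∃ a < h, ¬σ a ∧ i = a + 1 ∧ a + j = 2 * h

/-- A convex chain of `4 h` vertices with the distances and directions that make every antipodal
pair except `v k` and its mirror image or `v (k + 1)` and its mirror image a pair at unit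
distance. -/
structure UnitChain (h k : ℕ) (σ : ℕ → Prop) (ℓ : ℝ) (φ : ℕ → ℝ) (v : ℕ → Plane) : Prop
    extends ConvexChain (2 * h) ℓ φ v where
  index : (k + 1 = h ∧ σ (h - 1)) ∨ (k = h ∧ ¬σ (h - 1))
  add_le : ∀ i < h, ¬σ i → φ i + φ (2 * h - 1 - i) ≤ π
  le_add : ∀ i < h, σ i → π ≤ φ i + φ (2 * h - 1 - i)
  add_le' : ∀ i, i + 1 < h → φ i + φ (2 * h - 2 - i) ≤ π
  le_add' : ∀ i, i + 1 < h → π ≤ φ (i + 1) + φ (2 * h - 1 - i)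
  add_self_le : k = h → φ (h - 1) + φ (h - 1) ≤ π
  le_add_self : k + 1 = h → π ≤ φ h + φ h
  dist_eq_one : ∀ i j, UnitPair h σ i j → dist (v i) (mirror (v j)) = 1
  dist_lt_one : dist (v k) (mirror (v k)) < 1
  dist_lt_one' : dist (v (k + 1)) (mirror (v (k + 1))) < 1

namespace UnitChain

variable {h k : ℕ} {σ : ℕ → Prop} {ℓ : ℝ} {φ : ℕ → ℝ} {v : ℕ → Plane}

lemma mirror_zero (C : UnitChain h k σ ℓ φ v) : mirror (v 0) = v 0 :=
  plane_ext (by simp [C.fst_zero]) (by simp)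

lemma mirror_mid (C : UnitChain h k σ ℓ φ v) : mirror (v (2 * h)) = v (2 * h) :=
  plane_ext (by simp [C.toConvexChain.fst_mid]) (by simp)

/-- Maximality yields `A` for the outgoing and `B` for the incoming directions. If `i + j` is below
`2 * h - 1`, the inequality `add_le'` contradicts `A`; if it is above `2 * h + 1`, then `le_add'`
contradicts `B`. For `i + j = 2 * h ± 1` the value of `σ` decides which pairs survive. Near the
middle the argument leaves exactly the two horizontal pairs at `k` and `k + 1`. -/
lemma unitPair_of_max_aux (C : UnitChain h k σ ℓ φ v) {i j : ℕ} (hij : i ≤ j) (hj : j ≤ 2 * h)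
    (hne : v i ≠ mirror (v j))
    (hmax : ∀ p ≤ 2 * h, ∀ q ≤ 2 * h, dist (v p) (mirror (v q)) ≤ dist (v i) (mirror (v j))) :
    UnitPair h σ i j ∨ (i = j ∧ (i = k ∨ i = k + 1)) := by
  have hh := C.two_le
  have hk : k + 1 = h ∨ k = h := C.index.imp And.left And.left
  have A : i < 2 * h → j < 2 * h → π < φ i + φ j := by
    intro h1 h2
    refine C.toConvexChain.pi_lt_add h1 h2 hmax ?_
    by_contra hcon
    obtain ⟨rfl, rfl⟩ : i = 0 ∧ j = 0 := by omega
    exact hne C.mirror_zero.symm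
  have B : 1 ≤ i → φ (i - 1) + φ (j - 1) < π := by
    intro h1
    refine C.toConvexChain.add_lt_pi (by omega) (by omega) ?_ ?_
    · rwa [show i - 1 + 1 = i by omega, show j - 1 + 1 = j by omega]
    by_contra hcon
    obtain ⟨rfl, rfl⟩ : i = 2 * h ∧ j = 2 * h := by omega
    exact hne C.mirror_mid.symm
  have M := fun {a b : ℕ} => C.toConvexChain.mono (i := a) (j := b)
  rcases (by omega : i + j + 2 ≤ 2 * h ∨ i + j + 1 = 2 * h ∨ i + j = 2 * h ∨ i + j = 2 * h + 1 ∨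
    2 * h + 2 ≤ i + j) with e | e | e | e | e
  · have a := A (by omega) (by omega)
    rcases (by omega : i + 1 < h ∨ i + 1 = h) with c | c
    · have := C.add_le' i c
      have := M (a := j) (b := 2 * h - 2 - i) (by omega) (by omega)
      linarith
    · obtain rfl : i = j := by omega
      rcases hk with hk | hk
      · exact Or.inr ⟨rfl, by omega⟩
      · have := C.add_self_le hk
        rw [show h - 1 = i by omega] at this
        linarith
  · by_cases hs : σ i
    · exact Or.inl (Or.inr (Or.inl ⟨by omega, hs, e⟩))
    · have := C.add_le i (by omega) hs
      rw [show 2 * h - 1 - i = j by omega] at this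
      linarith [A (by omega) (by omega)]
  · by_cases hi : i < h
    · exact Or.inl (Or.inl ⟨hi, e⟩)
    · exact Or.inr ⟨by omega, by omega⟩
  · by_cases hs : σ (i - 1)
    · have := C.le_add (i - 1) (by omega) hs
      rw [show 2 * h - 1 - (i - 1) = j - 1 by omega] at this
      linarith [B (by omega)]
    · exact Or.inl (Or.inr (Or.inr ⟨i - 1, by omega, hs, by omega, by omega⟩))
  · have b := B (by omega)
    by_cases hi : i - 1 < h
    · have := C.le_add' (i - 2) (by omega)
      rw [show i - 2 + 1 = i - 1 by omega] at this
      have := M (a := 2 * h - 1 - (i - 2)) (b := j - 1) (by omega) (by omega)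
      linarith
    · rcases hk with hk | hk
      · have := C.le_add_self hk
        have := M (a := h) (b := i - 1) (by omega) (by omega)
        have := M (a := h) (b := j - 1) (by omega) (by omega)
        linarith
      · by_cases hj' : j = h + 1
        · exact Or.inr ⟨by omega, by omega⟩
        · have := C.le_add' (h - 2) (by omega)
          have := M (a := h - 2 + 1) (b := i - 1) (by omega) (by omega)
          have := M (a := 2 * h - 1 - (h - 2)) (b := j - 1) (by omega) (by omega)
          linarith

lemma dist_mirror_comm (a b : Plane) : dist a (mirror b) = dist b (mirror a) := by
  rw [← dist_mirror, mirror_mirror, dist_comm]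

lemma unitPair_of_max (C : UnitChain h k σ ℓ φ v) {i j : ℕ} (hi : i ≤ 2 * h) (hj : j ≤ 2 * h)
    (hne : v i ≠ mirror (v j))
    (hmax : ∀ p ≤ 2 * h, ∀ q ≤ 2 * h, dist (v p) (mirror (v q)) ≤ dist (v i) (mirror (v j))) :
    UnitPair h σ i j ∨ UnitPair h σ j i ∨ (i = j ∧ (i = k ∨ i = k + 1)) := by
  rcases le_total i j with hij | hij
  · rcases C.unitPair_of_max_aux hij hj hne hmax with h | h
    · exact Or.inl h
    · exact Or.inr (Or.inr h)
  · rcases C.unitPair_of_max_aux hij hi (by rw [← dist_pos] at hne ⊢; rwa [dist_mirror_comm])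
      (by rw [dist_mirror_comm (v j)]; exact hmax) with h | h
    · exact Or.inr (Or.inl h)
    · exact Or.inr (Or.inr (by omega))

lemma same_side_of_max (C : UnitChain h k σ ℓ φ v) {i j : ℕ} (hij : i < j) (hj : j ≤ 2 * h)
    (hmax : ∀ p ≤ 2 * h, ∀ q ≤ 2 * h, dist (v p) (v q) ≤ dist (v i) (v j)) :
    i = 0 ∨ j = 2 * h := by
  by_contra hcon
  exact C.toConvexChain.not_max_same_side (i := i) (j := j) (by omega) hij (by omega) hmax

/-- No two vertices are at distance greater than one. -/
lemma dist_le_one_aux (C : UnitChain h k σ ℓ φ v) :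
    (∀ p ≤ 2 * h, ∀ q ≤ 2 * h, dist (v p) (v q) ≤ 1) ∧
      ∀ p ≤ 2 * h, ∀ q ≤ 2 * h, dist (v p) (mirror (v q)) ≤ 1 := by
  have hh := C.two_le
  have ne : (Finset.range (2 * h + 1) ×ˢ Finset.range (2 * h + 1)).Nonempty := ⟨(0, 0), by simp⟩
  obtain ⟨⟨a, b⟩, hab, mab⟩ := Finset.exists_max_image _ (fun x : ℕ × ℕ => dist (v x.1) (v x.2)) ne
  obtain ⟨⟨i, j⟩, hij, mij⟩ :=
    Finset.exists_max_image _ (fun x : ℕ × ℕ => dist (v x.1) (mirror (v x.2))) ne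
  simp only [Finset.mem_product, Finset.mem_range, Prod.forall] at hab mab hij mij
  have mab' : ∀ p ≤ 2 * h, ∀ q ≤ 2 * h, dist (v p) (v q) ≤ dist (v a) (v b) :=
    fun p hp q hq => mab p q ⟨by omega, by omega⟩
  have mij' : ∀ p ≤ 2 * h, ∀ q ≤ 2 * h, dist (v p) (mirror (v q)) ≤ dist (v i) (mirror (v j)) :=
    fun p hp q hq => mij p q ⟨by omega, by omega⟩
  have one_le : 1 ≤ dist (v i) (mirror (v j)) := by
    rw [← C.dist_eq_one 0 (2 * h) (Or.inl ⟨by omega, by omega⟩)]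
    exact mij' 0 (by omega) (2 * h) (by omega)
  have le_one : dist (v i) (mirror (v j)) ≤ 1 := by
    rcases C.unitPair_of_max (by omega) (by omega) (dist_pos.1 (by linarith)) mij' with c | c | c
    · exact (C.dist_eq_one _ _ c).le
    · rw [dist_mirror_comm]; exact (C.dist_eq_one _ _ c).le
    · obtain ⟨rfl, rfl | rfl⟩ := c
      · exact C.dist_lt_one.le
      · exact C.dist_lt_one'.le
  -- A farthest pair within the closed right half has an end on the axis. That end is its own
  -- reflection, so the pair also counts as one of opposite vertices.
  have key : ∀ a b, a < b → b ≤ 2 * h →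
      (∀ p ≤ 2 * h, ∀ q ≤ 2 * h, dist (v p) (v q) ≤ dist (v a) (v b)) →
      dist (v a) (v b) ≤ 1 := by
    intro a b hlt hb hm
    rcases C.same_side_of_max hlt hb hm with rfl | rfl
    · rw [dist_comm, ← C.mirror_zero]
      exact (mij' b hb 0 (by omega)).trans le_one
    · rw [← C.mirror_mid]
      exact (mij' a (by omega) (2 * h) (by omega)).trans le_one
  refine ⟨fun p hp q hq => (mab' p hp q hq).trans ?_,
    fun p hp q hq => (mij' p hp q hq).trans le_one⟩
  rcases lt_trichotomy a b with c | rfl | c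
  · exact key a b c (by omega) mab'
  · simp
  · rw [dist_comm]
    exact key b a c (by omega) (by rwa [dist_comm (v b)])

lemma exists_right (C : UnitChain h k σ ℓ φ v) {p : ℕ} (hp : p ≤ 4 * h) :
    (p ≤ 2 * h) ∨ ∃ a ≤ 2 * h, p + a = 4 * h ∧ v p = mirror (v a) := by
  rcases le_or_gt p (2 * h) with c | c
  · exact Or.inl c
  · exact Or.inr ⟨4 * h - p, by omega, by omega, by
      rw [show 4 * h - p = 2 * (2 * h) - p by omega, C.mirror_eq (by omega)]⟩

theorem dist_le_one (C : UnitChain h k σ ℓ φ v) {p q : ℕ} (hp : p ≤ 4 * h) (hq : q ≤ 4 * h) :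
    dist (v p) (v q) ≤ 1 := by
  obtain ⟨c1, c2⟩ := C.dist_le_one_aux
  rcases C.exists_right hp with hp | ⟨a, ha, -, ea⟩ <;>
    rcases C.exists_right hq with hq | ⟨b, hb, -, eb⟩
  · exact c1 p hp q hq
  · rw [eb]; exact c2 p hp b hb
  · rw [ea, dist_comm]; exact c2 q hq a ha
  · rw [ea, eb, dist_mirror]; exact c1 a ha b hb

/-- `q` is the index of the mirror image of the vertex `j`. -/
def IsMirrorIndex (h q j : ℕ) : Prop := q + j = 4 * h ∨ (q = 0 ∧ j = 0)

lemma unitPair_of_opposite (C : UnitChain h k σ ℓ φ v) {i j : ℕ} (hi : i ≤ 2 * h) (hj : j ≤ 2 * h)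
    (e : dist (v i) (mirror (v j)) = 1) : UnitPair h σ i j ∨ UnitPair h σ j i := by
  rcases C.unitPair_of_max hi hj (dist_pos.1 (by linarith))
    (by rw [e]; exact C.dist_le_one_aux.2) with c | c | c
  · exact Or.inl c
  · exact Or.inr c
  · obtain ⟨rfl, rfl | rfl⟩ := c
    · exact absurd e C.dist_lt_one.ne
    · exact absurd e C.dist_lt_one'.ne

/-- Once 1 is known to be the largest distance, every pair at distance 1 is maximal and the
classification of maximal pairs applies. The four alternatives record which end is reflected and the
order of the ends. -/
theorem unitPair_of_dist_eq_one (C : UnitChain h k σ ℓ φ v) {p q : ℕ} (hp : p < 4 * h)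
    (hq : q < 4 * h) (e : dist (v p) (v q) = 1) :
    ∃ i j, UnitPair h σ i j ∧
      ((p = i ∧ IsMirrorIndex h q j) ∨ (q = i ∧ IsMirrorIndex h p j) ∨
        (IsMirrorIndex h p i ∧ q = j) ∨ (IsMirrorIndex h q i ∧ p = j)) := by
  have same : ∀ a b, a < b → b ≤ 2 * h → dist (v a) (v b) = 1 →
      (a = 0 ∧ (UnitPair h σ b 0 ∨ UnitPair h σ 0 b)) ∨
      (b = 2 * h ∧ (UnitPair h σ a (2 * h) ∨ UnitPair h σ (2 * h) a)) := by
    intro a b hab hb e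
    rcases C.same_side_of_max hab hb (by rw [e]; exact C.dist_le_one_aux.1) with rfl | rfl
    · exact Or.inl ⟨rfl, C.unitPair_of_opposite hb (by omega)
        (by rw [C.mirror_zero, dist_comm]; exact e)⟩
    · exact Or.inr ⟨rfl, C.unitPair_of_opposite hab.le le_rfl (by rw [C.mirror_mid]; exact e)⟩
  have ne : v p ≠ v q := dist_pos.1 (by linarith)
  unfold IsMirrorIndex
  rcases C.exists_right hp.le with hp' | ⟨a, ha, ea, ea'⟩ <;>
    rcases C.exists_right hq.le with hq' | ⟨b, hb, eb, eb'⟩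
  · rcases lt_trichotomy p q with c | c | c
    · rcases same p q c hq' e with ⟨h0, u | u⟩ | ⟨h0, u | u⟩ <;> exact ⟨_, _, u, by omega⟩
    · exact absurd (congrArg v c) ne
    · rcases same q p c hp' (by rwa [dist_comm]) with ⟨h0, u | u⟩ | ⟨h0, u | u⟩ <;>
        exact ⟨_, _, u, by omega⟩
  · rw [eb'] at e
    rcases C.unitPair_of_opposite hp' hb e with u | u <;> exact ⟨_, _, u, by omega⟩
  · rw [ea', dist_comm] at e
    rcases C.unitPair_of_opposite hq' ha e with u | u <;> exact ⟨_, _, u, by omega⟩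
  · rw [ea', eb', dist_mirror] at e
    rcases lt_trichotomy a b with c | c | c
    · rcases same a b c hb e with ⟨h0, u | u⟩ | ⟨h0, u | u⟩ <;> exact ⟨_, _, u, by omega⟩
    · exact absurd (by rw [ea', eb', c]) ne
    · rcases same b a c ha (by rwa [dist_comm]) with ⟨h0, u | u⟩ | ⟨h0, u | u⟩ <;>
        exact ⟨_, _, u, by omega⟩

theorem dist_eq_one_of_unitPair (C : UnitChain h k σ ℓ φ v) {i j q : ℕ} (u : UnitPair h σ i j)
    (hj : j ≤ 4 * h) (hq : IsMirrorIndex h q j) : dist (v i) (v q) = 1 := by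
  rw [← C.dist_eq_one i j u]
  rcases hq with hq | ⟨rfl, rfl⟩
  · rw [← C.symm j (by omega), show 2 * (2 * h) - j = q by omega]
  · rw [C.mirror_zero]

end UnitChain

/-! ### Polygons from chains -/

lemma val_finRotate {n : ℕ} (hn : 0 < n) (i : Fin n) :
    ((finRotate n i : Fin n) : ℕ) = if (i : ℕ) + 1 = n then 0 else (i : ℕ) + 1 := by
  obtain ⟨n, rfl⟩ : ∃ n', n = n' + 1 := ⟨n - 1, by omega⟩
  rw [coe_finRotate]
  have := i.isLt
  rcases eq_or_ne i (Fin.last n) with h | h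
  · simp [h]
  · have : (i : ℕ) ≠ n := fun e => h (Fin.ext e)
    simp [h, this]

namespace UnitChain

variable {h k : ℕ} {σ : ℕ → Prop} {ℓ : ℝ} {φ : ℕ → ℝ} {v : ℕ → Plane}
variable {n : ℕ} {P : Polygon Plane n}

lemma dist_finRotate (C : UnitChain h k σ ℓ φ v) (hn : n = 4 * h)
    (hP : ∀ i : Fin n, P.vertices i = v i) (i : Fin n) :
    dist (P.vertices i) (P.vertices (finRotate n i)) = ℓ := by
  have hi := i.isLt
  have hh := C.two_le
  rw [hP, hP, val_finRotate (by omega)]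
  split_ifs with c
  · rw [← C.toConvexChain.closed, show 2 * (2 * h) = (i : ℕ) + 1 by omega]
    exact C.toConvexChain.dist_succ (by omega)
  · exact C.toConvexChain.dist_succ (by omega)

theorem isConvexEquilateralSmall (C : UnitChain h k σ ℓ φ v) (hn : n = 4 * h)
    (hP : ∀ i : Fin n, P.vertices i = v i) : P.IsConvexEquilateralSmall := by
  have hh := C.two_le
  refine ⟨⟨by omega, fun i j k hij hjk => ?_⟩, ⟨ℓ, C.dist_finRotate hn hP⟩, ⟨?_, ?_⟩⟩
  · rw [hP, hP, hP]
    exact C.toConvexChain.orient_pos hij hjk (by have := k.isLt; omega)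
  · refine ⟨⟨0, by omega⟩, ⟨2 * h, by omega⟩, ?_⟩
    rw [hP, hP]
    exact (C.dist_eq_one_of_unitPair (i := 0) (q := 2 * h) (j := 2 * h)
      (Or.inl ⟨by omega, by omega⟩) (by omega)
      
      (Or.inl (by omega))).symm
  · rintro d ⟨i, j, rfl⟩
    rw [hP, hP]
    exact C.dist_le_one (by have := i.isLt; omega) (by have := j.isLt; omega)

end UnitChain

theorem Polygon.perimeter_eq_of_sides {n : ℕ} {P : Polygon Plane n} {c : ℝ}
    (h : ∀ i, dist (P.vertices i) (P.vertices (finRotate n i)) = c) : P.perimeter = n * c := by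
  rw [Polygon.perimeter, Finset.sum_congr rfl fun i _ => h i]
  simp

/-! ### Polygons with diameters in the directions `k t` -/

section pattern

variable (σ : ℕ → Prop) [DecidablePred σ]

/-- The vector from `v_{n-j}` to `v_{n-j-1}`, where `σ j` tells whether the diameter of direction
`(2j+1) t` ends in `v_{n-j}` or in `v_{n-j-1}`. -/
noncomputable def patternStep (t : ℝ) (j : ℕ) : Plane :=
  if σ j then unitDir ((2 * j + 1) * t) - unitDir ((2 * j + 2) * t)
  else unitDir (2 * j * t) - unitDir ((2 * j + 1) * t)

/-- The vertex `v_{n-a}`. -/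
noncomputable def patternLow (t : ℝ) (a : ℕ) : Plane := ∑ j ∈ Finset.range a, patternStep σ t j

/-- The vertex `v_{n/2-a}`. -/
noncomputable def patternHigh (t : ℝ) (a : ℕ) : Plane := patternLow σ t a + unitDir (2 * a * t)

/-- The polygon with `4 h` vertices whose side from `v k` to `v (k + 1)` is not one of the
prescribed steps. -/
noncomputable def patternVertex (h k : ℕ) (t : ℝ) (i : ℕ) : Plane :=
  if i ≤ k then mirror (patternLow σ t i)
  else if i ≤ 2 * h then patternHigh σ t (2 * h - i)
  else if i < 4 * h - k then mirror (patternHigh σ t (i - 2 * h))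
  else patternLow σ t (4 * h - i)

/-- The angles of the lower sides. -/
noncomputable def lowAngle (t : ℝ) (j : ℕ) : ℝ := (2 * j + if σ j then 3 / 2 else 1 / 2) * t

/-- The angles of the upper sides. -/
noncomputable def highAngle (t : ℝ) (j : ℕ) : ℝ := (2 * j + if σ j then 1 / 2 else 3 / 2) * t

/-- The directions of the sides of the right half. -/
noncomputable def patternAngle (h k : ℕ) (t β : ℝ) (i : ℕ) : ℝ :=
  if i < k then lowAngle σ t i else if i = k then β else π - highAngle σ t (2 * h - 1 - i)

end pattern

section pattern

variable {σ : ℕ → Prop} [DecidablePred σ] {t : ℝ}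

lemma patternLow_zero : patternLow σ t 0 = 0 := by simp [patternLow]

lemma patternLow_succ (a : ℕ) : patternLow σ t (a + 1) = patternLow σ t a + patternStep σ t a := by
  simp [patternLow, Finset.sum_range_succ]

lemma sin_sub_sin_add_angle (x t : ℝ) :
    sin (x * t) - sin ((x + 1) * t) = -(2 * sin (t / 2) * cos ((x + 1 / 2) * t)) := by
  rw [show x * t = (x + 1 / 2) * t - t / 2 by ring,
    show (x + 1) * t = (x + 1 / 2) * t + t / 2 by ring, sin_sub, sin_add]
  ring

lemma cos_sub_cos_add_angle (x t : ℝ) :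
    cos (x * t) - cos ((x + 1) * t) = 2 * sin (t / 2) * sin ((x + 1 / 2) * t) := by
  rw [show x * t = (x + 1 / 2) * t - t / 2 by ring,
    show (x + 1) * t = (x + 1 / 2) * t + t / 2 by ring, cos_sub, cos_add]
  ring

/-- A step is a chord of the unit circle spanning the angle `t`: its length is `2 sin (t / 2)`, and
its direction is perpendicular to the bisecting radius. -/
lemma patternStep_fst (j : ℕ) :
    patternStep σ t j 0 = -(2 * sin (t / 2) * cos (lowAngle σ t j)) := by
  unfold patternStep lowAngle
  split_ifs
  · have := sin_sub_sin_add_angle (2 * j + 1) t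
    rw [show (2 * j + 1 + 1 : ℝ) = 2 * j + 2 by ring,
      show (2 * j + 1 + 1 / 2 : ℝ) = 2 * j + 3 / 2 by ring] at this
    simpa using this
  · simpa using sin_sub_sin_add_angle (2 * j) t

lemma patternStep_snd (j : ℕ) :
    patternStep σ t j 1 = 2 * sin (t / 2) * sin (lowAngle σ t j) := by
  unfold patternStep lowAngle
  split_ifs
  · have := cos_sub_cos_add_angle (2 * j + 1) t
    rw [show (2 * j + 1 + 1 : ℝ) = 2 * j + 2 by ring,
      show (2 * j + 1 + 1 / 2 : ℝ) = 2 * j + 3 / 2 by ring] at this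
    simpa using this
  · simpa using cos_sub_cos_add_angle (2 * j) t

/-- Together with `patternHigh_eq_of_neg` this exhibits the diameter of odd direction. It also shows
that an upper side is a chord as well, whose angle is the one that the lower side with the same
index does not use. -/
lemma patternHigh_succ_of_pos {a : ℕ} (ha : σ a) :
    patternHigh σ t (a + 1) = patternLow σ t a + unitDir ((2 * a + 1) * t) := by
  rw [patternHigh, patternLow_succ, patternStep, if_pos ha]
  push_cast
  rw [show (2 * (a + 1) : ℝ) = 2 * a + 2 by ring]
  abel

lemma patternHigh_eq_of_neg {a : ℕ} (ha : ¬σ a) :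
    patternHigh σ t a = patternLow σ t (a + 1) + unitDir ((2 * a + 1) * t) := by
  rw [patternHigh, patternLow_succ, patternStep, if_neg ha]
  abel

lemma patternHigh_succ_fst (a : ℕ) :
    patternHigh σ t (a + 1) 0 = patternHigh σ t a 0 + 2 * sin (t / 2) * cos (highAngle σ t a) := by
  by_cases ha : σ a
  · rw [patternHigh_succ_of_pos ha, patternHigh, highAngle, if_pos ha]
    have := sin_sub_sin_add_angle (2 * a) t
    simp only [PiLp.add_apply, unitDir_fst]
    linarith
  · rw [patternHigh_eq_of_neg ha, patternHigh, highAngle, if_neg ha]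
    have := sin_sub_sin_add_angle (2 * a + 1) t
    rw [show (2 * a + 1 + 1 : ℝ) = 2 * (a + 1 : ℕ) by push_cast; ring,
      show (2 * a + 1 + 1 / 2 : ℝ) = 2 * a + 3 / 2 by ring] at this
    simp only [PiLp.add_apply, unitDir_fst]
    linarith

lemma patternHigh_succ_snd (a : ℕ) :
    patternHigh σ t (a + 1) 1 = patternHigh σ t a 1 - 2 * sin (t / 2) * sin (highAngle σ t a) := by
  by_cases ha : σ a
  · rw [patternHigh_succ_of_pos ha, patternHigh, highAngle, if_pos ha]
    have := cos_sub_cos_add_angle (2 * a) t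
    simp only [PiLp.add_apply, unitDir_snd]
    linarith
  · rw [patternHigh_eq_of_neg ha, patternHigh, highAngle, if_neg ha]
    have := cos_sub_cos_add_angle (2 * a + 1) t
    rw [show (2 * a + 1 + 1 : ℝ) = 2 * (a + 1 : ℕ) by push_cast; ring,
      show (2 * a + 1 + 1 / 2 : ℝ) = 2 * a + 3 / 2 by ring] at this
    simp only [PiLp.add_apply, unitDir_snd]
    linarith

lemma lowAngle_le (ht : 0 < t) (j : ℕ) : lowAngle σ t j ≤ (2 * j + 3 / 2) * t := by
  unfold lowAngle; split_ifs <;> nlinarith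

lemma le_lowAngle (ht : 0 < t) (j : ℕ) : (2 * j + 1 / 2) * t ≤ lowAngle σ t j := by
  unfold lowAngle; split_ifs <;> nlinarith

lemma highAngle_le (ht : 0 < t) (j : ℕ) : highAngle σ t j ≤ (2 * j + 3 / 2) * t := by
  unfold highAngle; split_ifs <;> nlinarith

lemma le_highAngle (ht : 0 < t) (j : ℕ) : (2 * j + 1 / 2) * t ≤ highAngle σ t j := by
  unfold highAngle; split_ifs <;> nlinarith

lemma angle_step (ht : 0 < t) {i j : ℕ} (hij : i < j) :
    (2 * i + 3 / 2) * t < (2 * j + 1 / 2 : ℝ) * t := by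
  have : (i : ℝ) + 1 ≤ j := by exact_mod_cast hij
  nlinarith

/-! ### The exceptional side -/

/-- The equation says δ² = (1 - cos(t+η))² - 2(cos t - cos(t+η)), and the cosine decreases. The
bound serves twice: it confines the direction of the exceptional side, and it makes the two
horizontal pairs at its ends shorter than 1. -/
lemma abs_lt_one_sub_cos {t η δ : ℝ} (ht : 0 < t) (hη : 0 < η) (hs : t + η < π / 2)
    (e : δ ^ 2 + sin (t + η) ^ 2 = 4 * sin (t / 2) ^ 2) : |δ| < 1 - cos (t + η) := by
  have h1 : cos (t + η) < cos t :=
    cos_lt_cos_of_nonneg_of_le_pi_div_two ht.le hs.le (by linarith)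
  have h2 : cos t = 1 - 2 * sin (t / 2) ^ 2 := by
    have := cos_two_mul (t / 2)
    rw [show 2 * (t / 2) = t by ring] at this
    linarith [sin_sq_add_cos_sq (t / 2)]
  have h3 := sin_sq_add_cos_sq (t + η)
  refine abs_lt_of_sq_lt_sq ?_ (by linarith [cos_le_one (t + η)])
  nlinarith

/-- The deviation of the exceptional side from the vertical has tangent δ / sin(t+η). By the
preceding bound this is less in absolute value than (1 - cos(t+η)) / sin(t+η) = tan((t+η)/2). -/
lemma exists_direction {t η δ : ℝ} (ht : 0 < t) (hη : 0 < η) (hs : t + η < π / 2)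
    (e : δ ^ 2 + sin (t + η) ^ 2 = 4 * sin (t / 2) ^ 2) :
    ∃ β, π / 2 - (t + η) / 2 < β ∧ β < π / 2 + (t + η) / 2 ∧
      2 * sin (t / 2) * cos β = δ ∧ 2 * sin (t / 2) * sin β = sin (t + η) := by
  have hδ := abs_lt_one_sub_cos ht hη hs e
  set x := (t + η) / 2 with hx
  have hpi := pi_pos
  have sx : 0 < sin x := sin_pos_of_pos_of_lt_pi (by linarith) (by linarith)
  have cx : 0 < cos x := cos_pos_of_mem_Ioo ⟨by linarith, by linarith⟩
  have e1 : sin (t + η) = 2 * sin x * cos x := by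
    rw [← sin_two_mul]; congr 1; rw [hx]; ring
  have e2 : 1 - cos (t + η) = 2 * sin x ^ 2 := by
    have := cos_two_mul x
    rw [show 2 * x = t + η by rw [hx]; ring] at this
    linarith [sin_sq_add_cos_sq x]
  rw [e2] at hδ
  have st : 0 < sin (t / 2) := sin_pos_of_pos_of_lt_pi (by linarith) (by linarith)
  have ss : 0 < sin (t + η) := by rw [e1]; positivity
  refine ⟨π / 2 - arctan (δ / sin (t + η)), ?_, ?_, ?_, ?_⟩
  · have : arctan (δ / sin (t + η)) < x := by
      rw [← arctan_tan (x := x) (by linarith) (by linarith), arctan_strictMono.lt_iff_lt,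
        tan_eq_sin_div_cos, div_lt_div_iff₀ ss cx, e1]
      nlinarith [le_abs_self δ]
    linarith
  · have : -x < arctan (δ / sin (t + η)) := by
      rw [← arctan_tan (x := -x) (by linarith) (by linarith), arctan_strictMono.lt_iff_lt, tan_neg,
        tan_eq_sin_div_cos, ← neg_div, div_lt_div_iff₀ cx ss, e1]
      nlinarith [neg_abs_le δ]
    linarith
  all_goals
    have hr : √(1 + (δ / sin (t + η)) ^ 2) = 2 * sin (t / 2) / sin (t + η) := by
      rw [show 1 + (δ / sin (t + η)) ^ 2 = (2 * sin (t / 2) / sin (t + η)) ^ 2 by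
        field_simp; linarith, sqrt_sq (by positivity)]
  · rw [cos_pi_div_two_sub, sin_arctan, hr]
    field_simp
  · rw [sin_pi_div_two_sub, cos_arctan, hr]
    field_simp

end pattern

/-! ### From the side equation to a unit chain. -/

/-- The number `t` makes all sides of the polygon `patternVertex σ h k t` equal. -/
structure IsPatternAngle (σ : ℕ → Prop) [DecidablePred σ] (h k : ℕ) (t : ℝ) : Prop where
  two_le : 2 ≤ h
  index : (k + 1 = h ∧ σ (h - 1)) ∨ (k = h ∧ ¬σ (h - 1))
  pos : 0 < t
  lt : 4 * h * t < π
  eq : (2 * patternLow σ t k 0 + sin ((2 * h - 1) * t)) ^ 2 + cos ((2 * h - 1) * t) ^ 2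
    = 4 * sin (t / 2) ^ 2

namespace IsPatternAngle

variable {σ : ℕ → Prop} [DecidablePred σ] {h k : ℕ} {t : ℝ}

lemma patternVertex_low (i : ℕ) (hi : i ≤ k) :
    patternVertex σ h k t i = mirror (patternLow σ t i) := if_pos hi

lemma patternVertex_high (i : ℕ) (hk : k < i) (hi : i ≤ 2 * h) :
    patternVertex σ h k t i = patternHigh σ t (2 * h - i) := by
  rw [patternVertex, if_neg (by omega), if_pos hi]

lemma patternVertex_symm (hk : k ≤ h) (hh : 2 ≤ h) {i : ℕ} (hi : i ≤ 4 * h) :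
    patternVertex σ h k t (4 * h - i) = mirror (patternVertex σ h k t i) := by
  have z : mirror (0 : Plane) = 0 := plane_ext (by simp) (by simp)
  have y : mirror (patternHigh σ t 0) = patternHigh σ t 0 :=
    plane_ext (by simp [patternHigh, patternLow_zero]) (by simp)
  rcases (by omega : i ≤ k ∨ (k < i ∧ i < 2 * h) ∨ i = 2 * h ∨ (2 * h < i ∧ i < 4 * h - k) ∨
    4 * h - k ≤ i) with c | c | c | c | c
  · rw [patternVertex_low i c, mirror_mirror, patternVertex, if_neg (by omega), if_neg (by omega),
      if_neg (by omega), show 4 * h - (4 * h - i) = i by omega]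
  · rw [patternVertex_high i c.1 c.2.le, patternVertex, if_neg (by omega), if_neg (by omega),
      if_pos (by omega), show 4 * h - i - 2 * h = 2 * h - i by omega]
  · rw [c, show 4 * h - 2 * h = 2 * h by omega, patternVertex_high _ (by omega) le_rfl,
      Nat.sub_self, y]
  · rw [patternVertex_high _ (by omega) (by omega), patternVertex, if_neg (by omega),
      if_neg (by omega), if_pos (by omega), mirror_mirror,
      show 2 * h - (4 * h - i) = i - 2 * h by omega]
  · rw [patternVertex_low _ (by omega), patternVertex, if_neg (by omega),
      if_neg (by omega), if_neg (by omega)]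

lemma le (H : IsPatternAngle σ h k t) : k ≤ h := by have := H.index; omega

lemma le_succ (H : IsPatternAngle σ h k t) : h ≤ k + 1 := by have := H.index; omega

/-- The upper end of the exceptional side. -/
lemma patternHigh_exceptional (H : IsPatternAngle σ h k t) :
    patternHigh σ t (2 * h - (k + 1)) = patternLow σ t k + unitDir ((2 * h - 1) * t) := by
  have hh := H.two_le
  have c : (2 * ((h - 1 : ℕ) : ℝ) + 1) = 2 * h - 1 := by
    rw [Nat.cast_sub (by omega)]; push_cast; ring
  rcases H.index with ⟨hk, hs⟩ | ⟨hk, hs⟩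
  · have := patternHigh_succ_of_pos (t := t) hs
    rwa [c, show h - 1 + 1 = 2 * h - (k + 1) by omega, show h - 1 = k by omega] at this
  · have := patternHigh_eq_of_neg (t := t) hs
    rwa [c, show h - 1 + 1 = k by omega, show h - 1 = 2 * h - (k + 1) by omega] at this

/-- The general bound `(2 * i + 3 / 2) * t` is too weak for `i = h - 1`. That index occurs only when
`k = h`, and then `σ (h - 1)` fails, so the side has the smaller of its two possible angles.
`highAngle_le_of_lt` is the dual case. -/
lemma lowAngle_le_of_lt (H : IsPatternAngle σ h k t) {i : ℕ} (hi : i < k) :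
    lowAngle σ t i ≤ (2 * h - 3 / 2) * t := by
  have hk := H.le
  have ht := H.pos
  by_cases hl : i + 1 < h
  · have : (i : ℝ) + 2 ≤ h := by exact_mod_cast hl
    nlinarith [lowAngle_le (σ := σ) ht i]
  · have hs : ¬σ i := by
      rcases H.index with ⟨h1, h2⟩ | ⟨h1, h2⟩
      · omega
      · rwa [show h - 1 = i by omega] at h2
    have : (i : ℝ) + 1 ≤ h := by exact_mod_cast (show i + 1 ≤ h by omega)
    rw [lowAngle, if_neg hs]
    nlinarith

lemma highAngle_le_of_lt (H : IsPatternAngle σ h k t) {i : ℕ} (hi : k + i + 1 < 2 * h) :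
    highAngle σ t i ≤ (2 * h - 3 / 2) * t := by
  have hk := H.le_succ
  have ht := H.pos
  by_cases hl : i + 1 < h
  · have : (i : ℝ) + 2 ≤ h := by exact_mod_cast hl
    nlinarith [highAngle_le (σ := σ) ht i]
  · have hs : σ i := by
      rcases H.index with ⟨h1, h2⟩ | ⟨h1, h2⟩
      · rwa [show h - 1 = i by omega] at h2
      · omega
    have : (i : ℝ) + 1 ≤ h := by exact_mod_cast (show i + 1 ≤ h by omega)
    rw [highAngle, if_pos hs]
    nlinarith

lemma sin_half_pos (H : IsPatternAngle σ h k t) : 0 < sin (t / 2) := by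
  have : (2 : ℝ) ≤ h := by exact_mod_cast H.two_le
  refine sin_pos_of_pos_of_lt_pi (by linarith [H.pos]) ?_
  nlinarith [H.pos, H.lt]

/-- Monotonicity of the directions reduces to two facts: angles with different step indices do not
interleave, and the exceptional direction `β` separates the lower angles from the supplements of the
upper ones. -/
lemma convexChain (H : IsPatternAngle σ h k t) {β : ℝ} (h1 : (2 * h - 3 / 2) * t < β)
    (h2 : β < π - (2 * h - 3 / 2) * t)
    (e1 : 2 * sin (t / 2) * cos β = 2 * patternLow σ t k 0 + sin ((2 * h - 1) * t))
    (e2 : 2 * sin (t / 2) * sin β = cos ((2 * h - 1) * t)) :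
    ConvexChain (2 * h) (2 * sin (t / 2)) (patternAngle σ h k t β) (patternVertex σ h k t) := by
  have hh := H.two_le
  have hk := H.le
  have hk' := H.le_succ
  have ht := H.pos
  have hhr : (2 : ℝ) ≤ h := by exact_mod_cast hh
  have b0 : 0 < (2 * h - 3 / 2) * t := mul_pos (by linarith) ht
  have low_pos : ∀ i, 0 < lowAngle σ t i := fun i =>
    lt_of_lt_of_le (by positivity) (le_lowAngle ht i)
  have high_pos : ∀ i, 0 < highAngle σ t i := fun i =>
    lt_of_lt_of_le (by positivity) (le_highAngle ht i)
  refine ⟨by linarith [H.sin_half_pos], by omega, ?_, ?_, ?_, ?_, ?_, ?_, ?_⟩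
  · rw [patternVertex_low 0 (by omega), patternLow_zero]; simp
  · intro i hi
    rw [show 2 * (2 * h) = 4 * h by ring]
    exact patternVertex_symm hk hh (by omega)
  · intro i hi
    rcases lt_trichotomy i k with c | c | c
    · rw [patternVertex_low _ (by omega), patternVertex_low _ (by omega), patternAngle, if_pos c,
        mirror_fst, mirror_fst, patternLow_succ, PiLp.add_apply, patternStep_fst]
      ring
    · subst c
      rw [patternVertex_low _ le_rfl, patternVertex_high _ (by omega) (by omega), patternAngle,
        if_neg (lt_irrefl _), if_pos rfl, e1, H.patternHigh_exceptional, mirror_fst,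
        PiLp.add_apply, unitDir_fst]
      ring
    · rw [patternVertex_high _ (by omega) (by omega), patternVertex_high _ (by omega) (by omega),
        patternAngle, if_neg (by omega), if_neg (by omega), cos_pi_sub,
        show 2 * h - i = 2 * h - 1 - i + 1 by omega, patternHigh_succ_fst,
        show 2 * h - (i + 1) = 2 * h - 1 - i by omega]
      ring
  · intro i hi
    rcases lt_trichotomy i k with c | c | c
    · rw [patternVertex_low _ (by omega), patternVertex_low _ (by omega), patternAngle, if_pos c,
        mirror_snd, mirror_snd, patternLow_succ, PiLp.add_apply, patternStep_snd]
    · subst c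
      rw [patternVertex_low _ le_rfl, patternVertex_high _ (by omega) (by omega), patternAngle,
        if_neg (lt_irrefl _), if_pos rfl, e2, H.patternHigh_exceptional, mirror_snd,
        PiLp.add_apply, unitDir_snd]
    · rw [patternVertex_high _ (by omega) (by omega), patternVertex_high _ (by omega) (by omega),
        patternAngle, if_neg (by omega), if_neg (by omega), sin_pi_sub,
        show 2 * h - i = 2 * h - 1 - i + 1 by omega, patternHigh_succ_snd,
        show 2 * h - (i + 1) = 2 * h - 1 - i by omega]
      ring
  · intro i j hij hj
    unfold patternAngle
    rcases lt_trichotomy i k with c | c | c <;> rcases lt_trichotomy j k with d | d | d <;>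
      try omega
    · rw [if_pos c, if_pos d]
      linarith [lowAngle_le (σ := σ) ht i, le_lowAngle (σ := σ) ht j, angle_step ht hij]
    · rw [if_pos c, if_neg (by omega), if_pos d]
      linarith [H.lowAngle_le_of_lt c]
    · rw [if_pos c, if_neg (by omega), if_neg (by omega)]
      linarith [H.lowAngle_le_of_lt c, H.highAngle_le_of_lt (i := 2 * h - 1 - j) (by omega)]
    · rw [if_neg (by omega), if_pos c, if_neg (by omega), if_neg (by omega)]
      linarith [H.highAngle_le_of_lt (i := 2 * h - 1 - j) (by omega)]
    · rw [if_neg (by omega), if_neg (by omega), if_neg (by omega), if_neg (by omega)]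
      linarith [highAngle_le (σ := σ) ht (2 * h - 1 - j), le_highAngle (σ := σ) ht (2 * h - 1 - i),
        angle_step ht (show 2 * h - 1 - j < 2 * h - 1 - i by omega)]
  · intro i hi
    unfold patternAngle
    split_ifs with c d
    · exact low_pos i
    · linarith
    · linarith [H.highAngle_le_of_lt (i := 2 * h - 1 - i) (by omega)]
  · intro i hi
    unfold patternAngle
    split_ifs with c d
    · linarith [H.lowAngle_le_of_lt c]
    · linarith
    · linarith [high_pos (2 * h - 1 - i)]

lemma dist_eq_one_of_fst_snd {a b : Plane} {θ : ℝ} (e : b = a + unitDir θ) : dist a b = 1 := by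
  apply dist_eq_of_sq zero_le_one
  rw [e]
  simp

lemma lowAngle_lt_highAngle (ht : 0 < t) {i j : ℕ} (hij : i < j) :
    lowAngle σ t i < highAngle σ t j := by
  linarith [lowAngle_le (σ := σ) ht i, le_highAngle (σ := σ) ht j, angle_step ht hij]

lemma highAngle_lt_lowAngle (ht : 0 < t) {i j : ℕ} (hij : i < j) :
    highAngle σ t i < lowAngle σ t j := by
  linarith [highAngle_le (σ := σ) ht i, le_lowAngle (σ := σ) ht j, angle_step ht hij]

lemma dist_eq_one (H : IsPatternAngle σ h k t) {i j : ℕ} (u : UnitPair h σ i j) :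
    dist (patternVertex σ h k t i) (mirror (patternVertex σ h k t j)) = 1 := by
  have hh := H.two_le
  have hk := H.le
  have hk' := H.le_succ
  rcases u with ⟨hi, hj⟩ | ⟨hi, hs, hj⟩ | ⟨a, ha, hs, hi, hj⟩
  · rw [patternVertex_low _ (by omega), patternVertex_high _ (by omega) (by omega), dist_mirror,
      show 2 * h - j = i by omega]
    exact dist_eq_one_of_fst_snd rfl
  · have : k < j := by
      by_contra hcon
      rcases H.index with ⟨h1, h2⟩ | ⟨h1, h2⟩
      · omega
      · rw [show h - 1 = i by omega] at h2; exact h2 hs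
    rw [patternVertex_low _ (by omega), patternVertex_high _ (by omega) (by omega), dist_mirror,
      show 2 * h - j = i + 1 by omega]
    exact dist_eq_one_of_fst_snd (patternHigh_succ_of_pos hs)
  · have : i ≤ k := by
      by_contra hcon
      rcases H.index with ⟨h1, h2⟩ | ⟨h1, h2⟩
      · rw [show h - 1 = a by omega] at h2; exact hs h2
      · omega
    rw [patternVertex_low _ this, patternVertex_high _ (by omega) (by omega), dist_mirror,
      show 2 * h - j = a by omega, hi]
    exact dist_eq_one_of_fst_snd (patternHigh_eq_of_neg hs)

lemma dist_mirror_self (p : Plane) : dist p (mirror p) = |2 * p 0| := by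
  apply dist_eq_of_sq (abs_nonneg _)
  rw [sq_abs]; simp; ring

/-- Away from the exceptional side the directions `i` and `2 * h - 1 - i` add up to π plus the
difference of the lower and the upper angle of step `i`. This is `π + t` or `π - t` according to `σ
i`, which is why `σ` governs the unit pairs. -/
theorem exists_unitChain (H : IsPatternAngle σ h k t) :
    ∃ φ, UnitChain h k σ (2 * sin (t / 2)) φ (patternVertex σ h k t) := by
  have hh := H.two_le
  have hk := H.le
  have hk' := H.le_succ
  have ht := H.pos
  have hhr : (2 : ℝ) ≤ h := by exact_mod_cast hh
  -- The defect `η` measures how far the `4 * h` angles `t` fall short of filling `π`; the last odd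
  -- direction is `π / 2 - (t + η)`.
  obtain ⟨η, hη⟩ : ∃ η, η = π / 2 - 2 * h * t := ⟨_, rfl⟩
  have hη0 : 0 < η := by linarith [H.lt]
  have hlt : t + η < π / 2 := by nlinarith
  have ex : (2 * h - 1) * t = π / 2 - (t + η) := by rw [hη]; ring
  have es : sin ((2 * h - 1) * t) = cos (t + η) := by rw [ex, sin_pi_div_two_sub]
  have ec : cos ((2 * h - 1) * t) = sin (t + η) := by rw [ex, cos_pi_div_two_sub]
  have eq := H.eq
  rw [ec] at eq
  have hδ := abs_lt_one_sub_cos ht hη0 hlt eq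
  obtain ⟨β, b1, b2, e1, e2⟩ := exists_direction ht hη0 hlt eq
  have b1' : (2 * h - 3 / 2) * t < β := by linarith
  have b2' : β < π - (2 * h - 3 / 2) * t := by linarith
  have cpos : 0 < cos (t + η) := cos_pos_of_mem_Ioo ⟨by linarith, hlt⟩
  rw [← ec] at e2
  have C := H.convexChain b1' b2' e1 e2
  have low : ∀ i, i < k → patternAngle σ h k t β i = lowAngle σ t i := fun i hi => if_pos hi
  have high : ∀ i, k < i → patternAngle σ h k t β i = π - highAngle σ t (2 * h - 1 - i) := by
    intro i hi
    rw [patternAngle, if_neg (by omega), if_neg (by omega)]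
  have mid : ∀ i, i = k → patternAngle σ h k t β i = β := by
    rintro i rfl
    rw [patternAngle, if_neg (lt_irrefl _), if_pos rfl]
  refine ⟨_, C, H.index, ?_, ?_, ?_, ?_, ?_, ?_, ?_, ?_, ?_⟩
  · intro i hi hs
    have hik : i < k := by
      by_contra hcon
      rcases H.index with ⟨h1, h2⟩ | ⟨h1, h2⟩
      · rw [show h - 1 = i by omega] at h2; exact hs h2
      · omega
    rw [low i hik]
    rcases (by omega : k < 2 * h - 1 - i ∨ 2 * h - 1 - i = k) with c | c
    · rw [high _ c, show 2 * h - 1 - (2 * h - 1 - i) = i by omega, lowAngle, highAngle, if_neg hs,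
        if_neg hs]
      nlinarith
    · rw [mid _ c]
      linarith [H.lowAngle_le_of_lt hik]
  · intro i hi hs
    have hik : k < 2 * h - 1 - i := by
      by_contra hcon
      rcases H.index with ⟨h1, h2⟩ | ⟨h1, h2⟩
      · omega
      · rw [show h - 1 = i by omega] at h2; exact h2 hs
    rw [high _ hik, show 2 * h - 1 - (2 * h - 1 - i) = i by omega]
    rcases (by omega : i < k ∨ i = k) with c | c
    · rw [low _ c, lowAngle, highAngle, if_pos hs, if_pos hs]
      nlinarith
    · rw [mid _ c]
      linarith [H.highAngle_le_of_lt (i := i) (by omega)]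
  · intro i hi
    rw [low i (by omega)]
    rcases (by omega : k < 2 * h - 2 - i ∨ 2 * h - 2 - i = k) with c | c
    · rw [high _ c, show 2 * h - 1 - (2 * h - 2 - i) = i + 1 by omega]
      linarith [lowAngle_lt_highAngle (σ := σ) ht (Nat.lt_succ_self i)]
    · rw [mid _ c]
      linarith [H.lowAngle_le_of_lt (i := i) (by omega)]
  · intro i hi
    rw [high (2 * h - 1 - i) (by omega), show 2 * h - 1 - (2 * h - 1 - i) = i by omega]
    rcases (by omega : i + 1 < k ∨ i + 1 = k) with c | c
    · rw [low _ c]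
      linarith [highAngle_lt_lowAngle (σ := σ) ht (Nat.lt_succ_self i)]
    · rw [mid _ c]
      linarith [H.highAngle_le_of_lt (i := i) (by omega)]
  · intro c
    rw [low _ (by omega)]
    linarith [H.lowAngle_le_of_lt (i := h - 1) (by omega)]
  · intro c
    rw [high _ (by omega)]
    linarith [H.highAngle_le_of_lt (i := 2 * h - 1 - h) (by omega)]
  · exact fun i j u => H.dist_eq_one u
  · rw [dist_mirror_self, patternVertex_low _ le_rfl, mirror_fst, abs_lt]
    rw [es, abs_lt] at hδ
    constructor <;> linarith
  · rw [dist_mirror_self, patternVertex_high _ (by omega) (by omega), H.patternHigh_exceptional,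
      PiLp.add_apply, unitDir_fst, abs_lt]
    rw [es, abs_lt] at hδ
    rw [es]
    constructor <;> linarith

end IsPatternAngle

/-! ### The two step patterns and closed forms of their abscissas. -/

/-- The steps of the polygon `B`. -/
def BStep (j : ℕ) : Prop := j % 4 = 0 ∨ j % 4 = 3

instance : DecidablePred BStep := fun j => inferInstanceAs (Decidable (j % 4 = 0 ∨ j % 4 = 3))

/-- The steps of Mossinghoff's polygon. -/
def MStep (j : ℕ) : Prop := j = 0 ∨ j % 4 = 1 ∨ j % 4 = 2

instance : DecidablePred MStep :=
  fun j => inferInstanceAs (Decidable (j = 0 ∨ j % 4 = 1 ∨ j % 4 = 2))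

lemma sin_sub_add_sin_add (x y : ℝ) : sin (x - y) + sin (x + y) = 2 * sin x * cos y := by
  rw [sin_sub, sin_add]; ring

lemma patternStep_fst_of_pos {σ : ℕ → Prop} [DecidablePred σ] {t : ℝ} {j : ℕ} (h : σ j) :
    patternStep σ t j 0 = sin ((2 * j + 1) * t) - sin ((2 * j + 2) * t) := by
  rw [patternStep, if_pos h]; simp

lemma patternStep_fst_of_neg {σ : ℕ → Prop} [DecidablePred σ] {t : ℝ} {j : ℕ} (h : ¬σ j) :
    patternStep σ t j 0 = sin (2 * j * t) - sin ((2 * j + 1) * t) := by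
  rw [patternStep, if_neg h]; simp

/-- Four consecutive steps contribute (2 cos t - 1)(sin (8q+8)t - sin (8q+12)t), since the sines of
neighbouring odd multiples combine with the even multiple between them. After multiplication by 2
cos 2t this telescopes. -/
lemma patternLow_BStep (t : ℝ) (q : ℕ) :
    2 * cos (2 * t) * (patternLow BStep t (4 * q + 3) 0 - sin t) =
      -((2 * cos t - 1) * (sin (2 * t) + sin ((8 * q + 6) * t))) := by
  induction q with
  | zero =>
    simp only [patternLow_succ, patternLow_zero, mul_zero, zero_add, PiLp.add_apply]
    rw [patternStep_fst_of_pos (by simp [BStep]), patternStep_fst_of_neg (by simp [BStep]),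
      patternStep_fst_of_neg (by simp [BStep])]
    push_cast
    have h1 := sin_sub_add_sin_add (4 * t) t
    have h2 := sin_sub_add_sin_add (4 * t) (2 * t)
    ring_nf at h1 h2 ⊢
    linear_combination (2 * cos (t * 2)) * (-h1) + (2 * cos t - 1) * h2
  | succ q ih =>
    rw [show 4 * (q + 1) + 3 = 4 * q + 3 + 1 + 1 + 1 + 1 by ring]
    simp only [patternLow_succ (4 * q + 3 + 1 + 1 + 1), patternLow_succ (4 * q + 3 + 1 + 1),
      patternLow_succ (4 * q + 3 + 1), patternLow_succ (4 * q + 3), PiLp.add_apply]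
    rw [patternStep_fst_of_pos (j := 4 * q + 3) (by simp only [BStep]; omega),
      patternStep_fst_of_pos (j := 4 * q + 3 + 1) (by simp only [BStep]; omega),
      patternStep_fst_of_neg (j := 4 * q + 3 + 1 + 1) (by simp only [BStep]; omega),
      patternStep_fst_of_neg (j := 4 * q + 3 + 1 + 1 + 1) (by simp only [BStep]; omega)]
    push_cast
    have h1 := sin_sub_add_sin_add ((8 * q + 8) * t) t
    have h2 := sin_sub_add_sin_add ((8 * q + 8) * t) (2 * t)
    have h3 := sin_sub_add_sin_add ((8 * q + 12) * t) t
    have h4 := sin_sub_add_sin_add ((8 * q + 12) * t) (2 * t)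
    ring_nf at h1 h2 h3 h4 ih ⊢
    linear_combination ih + 2 * cos (t * 2) * (h1 - h3) + (2 * cos t - 1) * (h4 - h2)

/-- The same telescoping with the opposite sign. Here four steps also leave sin (8q+7)t - sin
(8q+15)t, which the extra term on the left absorbs. The irregular step `j = 0` accounts for sin t -
sin 2t. -/
lemma patternLow_MStep (t : ℝ) (q : ℕ) :
    2 * cos (2 * t) * (patternLow MStep t (4 * q + 4) 0 - sin t + sin (2 * t)
        + sin ((8 * q + 7) * t)) =
      (2 * cos t - 1) * (sin (2 * t) + sin ((8 * q + 6) * t)) := by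
  induction q with
  | zero =>
    simp only [patternLow_succ, patternLow_zero, mul_zero, zero_add, PiLp.add_apply]
    rw [patternStep_fst_of_pos (by simp [MStep]), patternStep_fst_of_pos (by simp [MStep]),
      patternStep_fst_of_pos (by simp [MStep]), patternStep_fst_of_neg (by simp [MStep])]
    push_cast
    have h1 := sin_sub_add_sin_add (4 * t) t
    have h2 := sin_sub_add_sin_add (4 * t) (2 * t)
    ring_nf at h1 h2 ⊢
    linear_combination (2 * cos (t * 2)) * h1 - (1 - 2 * cos t) * (-h2)
  | succ q ih =>
    rw [show 4 * (q + 1) + 4 = 4 * q + 4 + 1 + 1 + 1 + 1 by ring]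
    simp only [patternLow_succ (4 * q + 4 + 1 + 1 + 1), patternLow_succ (4 * q + 4 + 1 + 1),
      patternLow_succ (4 * q + 4 + 1), patternLow_succ (4 * q + 4), PiLp.add_apply]
    rw [patternStep_fst_of_neg (j := 4 * q + 4) (by simp only [MStep]; omega),
      patternStep_fst_of_pos (j := 4 * q + 4 + 1) (by simp only [MStep]; omega),
      patternStep_fst_of_pos (j := 4 * q + 4 + 1 + 1) (by simp only [MStep]; omega),
      patternStep_fst_of_neg (j := 4 * q + 4 + 1 + 1 + 1) (by simp only [MStep]; omega)]
    push_cast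
    have h1 := sin_sub_add_sin_add ((8 * q + 8) * t) t
    have h2 := sin_sub_add_sin_add ((8 * q + 8) * t) (2 * t)
    have h3 := sin_sub_add_sin_add ((8 * q + 12) * t) t
    have h4 := sin_sub_add_sin_add ((8 * q + 12) * t) (2 * t)
    ring_nf at h1 h2 h3 h4 ih ⊢
    linear_combination ih - 2 * cos (t * 2) * (h1 - h3) - (2 * cos t - 1) * (h4 - h2)

/-! ### Existence of the side angle. -/

/-- The difference of the squared lengths of the exceptional side and of the other sides. -/
noncomputable def sideExcess (σ : ℕ → Prop) [DecidablePred σ] (h k : ℕ) (t : ℝ) : ℝ :=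
  (2 * patternLow σ t k 0 + sin ((2 * h - 1) * t)) ^ 2 + cos ((2 * h - 1) * t) ^ 2
    - 4 * sin (t / 2) ^ 2

section excess

variable {σ : ℕ → Prop} [DecidablePred σ] {h k : ℕ}

lemma continuous_patternLow_fst (a : ℕ) : Continuous fun t => patternLow σ t a 0 := by
  induction a with
  | zero => simp only [patternLow_zero]; exact continuous_const
  | succ a ih =>
    have hl : Continuous fun t => lowAngle σ t a := continuous_const.mul continuous_id
    simp only [patternLow_succ, PiLp.add_apply, patternStep_fst]
    exact ih.add ((continuous_const.mul (continuous_sin.comp (continuous_id.div_const 2))).mul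
      (continuous_cos.comp hl)).neg

lemma continuous_sideExcess : Continuous (sideExcess σ h k) := by
  have hl : Continuous fun t : ℝ => (2 * h - 1 : ℝ) * t := continuous_const.mul continuous_id
  have hs : Continuous fun t : ℝ => sin (t / 2) := continuous_sin.comp (continuous_id.div_const 2)
  exact ((((continuous_const.mul (continuous_patternLow_fst k)).add
    (continuous_sin.comp hl)).pow 2).add ((continuous_cos.comp hl).pow 2)).sub
      (continuous_const.mul (hs.pow 2))

/-- For η ≥ t/2 the vertical extent of the exceptional side alone exceeds the length of the other
sides. The reason is that sin 3x = 3 sin x - 4 sin³ x > 2 sin x as long as 0 < sin x < 1/2. -/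
lemma two_mul_sin_half_lt {t η : ℝ} (ht : 0 < t) (ht' : t < π / 3) (hη : t / 2 ≤ η)
    (hs : t + η ≤ π / 2) : 2 * sin (t / 2) < sin (t + η) := by
  have h1 : sin (3 * (t / 2)) ≤ sin (t + η) :=
    sin_le_sin_of_le_of_le_pi_div_two (by linarith [pi_pos]) hs (by linarith)
  rw [sin_three_mul] at h1
  have h2 : 0 < sin (t / 2) := sin_pos_of_pos_of_lt_pi (by linarith) (by linarith [pi_pos])
  have h3 : sin (t / 2) < 1 / 2 := by
    rw [← sin_pi_div_six]
    exact sin_lt_sin_of_lt_of_le_pi_div_two (by linarith [pi_pos]) (by linarith [pi_pos])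
      (by linarith)
  have : 0 < sin (t / 2) * ((1 / 2 - sin (t / 2)) * (1 / 2 + sin (t / 2))) := by
    have : 0 < 1 / 2 - sin (t / 2) := by linarith
    positivity
  nlinarith

/-- The angle `t` is at least `π / (n + 1)`. -/
lemma IsPatternAngle.half_pi_sub_lt (H : IsPatternAngle σ h k t) :
    π / 2 - 2 * h * t < t / 2 := by
  by_contra hcon
  push Not at hcon
  have hh : (2 : ℝ) ≤ h := by exact_mod_cast H.two_le
  have := H.lt
  have ht := H.pos
  have key := two_mul_sin_half_lt (η := π / 2 - 2 * h * t) ht (by nlinarith) hcon (by nlinarith)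
  have e := H.eq
  rw [show (2 * h - 1) * t = π / 2 - (t + (π / 2 - 2 * h * t)) by ring, sin_pi_div_two_sub,
    cos_pi_div_two_sub] at e
  have := H.sin_half_pos
  nlinarith [sq_nonneg (2 * patternLow σ t k 0 + cos (t + (π / 2 - 2 * h * t)))]

/-- At π/(4h+1) the defect is t/2, and the excess is positive whatever the pattern. So only the sign
at π/(4h) has to be checked for a given pattern. -/
lemma exists_isPatternAngle (hh : 2 ≤ h) (index : (k + 1 = h ∧ σ (h - 1)) ∨ (k = h ∧ ¬σ (h - 1)))
    (hneg : sideExcess σ h k (π / (4 * h)) < 0) : ∃ t, IsPatternAngle σ h k t := by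
  have hhr : (2 : ℝ) ≤ h := by exact_mod_cast hh
  have hpi := pi_pos
  have hle : π / (4 * h + 1) ≤ π / (4 * h) :=
    div_le_div_of_nonneg_left hpi.le (by linarith) (by linarith)
  have hpos : 0 < sideExcess σ h k (π / (4 * h + 1)) := by
    obtain ⟨t, ht⟩ : ∃ t, t = π / (4 * h + 1) := ⟨_, rfl⟩
    have ht0 : 0 < t := by rw [ht]; positivity
    have e : (4 * h + 1) * t = π := by rw [ht]; field_simp
    rw [← ht, sideExcess]
    have key := two_mul_sin_half_lt (η := t / 2) ht0 (by nlinarith) le_rfl (by nlinarith)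
    rw [show (2 * h - 1) * t = π / 2 - (t + t / 2) by linarith, sin_pi_div_two_sub,
      cos_pi_div_two_sub]
    have : 0 < sin (t / 2) := sin_pos_of_pos_of_lt_pi (by linarith) (by nlinarith)
    nlinarith [sq_nonneg (2 * patternLow σ t k 0 + cos (t + t / 2))]
  obtain ⟨t, ⟨h1, h2⟩, h3⟩ := intermediate_value_Ioo' hle
    (continuous_sideExcess (σ := σ) (h := h) (k := k)).continuousOn ⟨hneg, hpos⟩
  refine ⟨t, hh, index, lt_trans (by positivity) h1, ?_, ?_⟩
  · rw [lt_div_iff₀ (by positivity)] at h2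
    linarith
  · rw [sideExcess] at h3
    linarith

/-- With `η = π / 2 - n t / 2` and the abscissa `x` of `v_{n-k}`, the equation for `t`. -/
lemma IsPatternAngle.eq_of_fst (H : IsPatternAngle σ h k t) {η : ℝ} (hη : η = π / 2 - 2 * h * t) :
    (2 * patternLow σ t k 0 + cos (t + η)) ^ 2 =
      (1 - cos (t + η)) ^ 2 - 2 * (cos t - cos (t + η)) := by
  have e := H.eq
  rw [show (2 * h - 1) * t = π / 2 - (t + η) by rw [hη]; ring, sin_pi_div_two_sub,
    cos_pi_div_two_sub] at e
  have h2 : cos t = 1 - 2 * sin (t / 2) ^ 2 := by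
    have := cos_two_mul (t / 2)
    rw [show 2 * (t / 2) = t by ring] at this
    linarith [sin_sq_add_cos_sq (t / 2)]
  have := sin_sq_add_cos_sq (t + η)
  rw [h2]
  linarith

end excess

/-- Elementary bounds for the angles that occur. -/
lemma sin_lt_cos_bounds {t : ℝ} (h0 : 0 < t) (h1 : t ≤ π / 16) :
    0 < sin t ∧ sin t < 1 / 5 ∧ 0 < cos t ∧ cos t < 1 ∧ 9 / 10 < cos (2 * t) := by
  have hpi := pi_lt_d2
  have s0 : 0 < sin t := sin_pos_of_pos_of_lt_pi h0 (by linarith)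
  have s1 : sin t < 1 / 5 := (sin_lt h0).trans (by linarith)
  have c0 : 0 < cos t := cos_pos_of_mem_Ioo ⟨by linarith, by linarith [pi_pos]⟩
  have h := sin_sq_add_cos_sq t
  refine ⟨s0, s1, c0, by nlinarith, ?_⟩
  rw [cos_two_mul]
  nlinarith

lemma sideExcess_eq (σ : ℕ → Prop) [DecidablePred σ] {h k : ℕ} (hh : 0 < h) {t : ℝ}
    (ht : t = π / (4 * h)) :
    sideExcess σ h k t = (2 * patternLow σ t k 0 + cos t) ^ 2 - (1 - cos t) ^ 2 := by
  have hh' : (0 : ℝ) < h := by exact_mod_cast hh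
  have e : 4 * h * t = π := by rw [ht]; field_simp
  have h2 : cos t = 1 - 2 * sin (t / 2) ^ 2 := by
    have := cos_two_mul (t / 2)
    rw [show 2 * (t / 2) = t by ring] at this
    linarith [sin_sq_add_cos_sq (t / 2)]
  rw [sideExcess, show (2 * h - 1) * t = π / 2 - t by linarith, sin_pi_div_two_sub,
    cos_pi_div_two_sub]
  have := sin_sq_add_cos_sq t
  linarith

lemma BStep_index {q : ℕ} : (4 * q + 3 + 1 = 4 * q + 4 ∧ BStep (4 * q + 4 - 1)) ∨
    (4 * q + 3 = 4 * q + 4 ∧ ¬BStep (4 * q + 4 - 1)) := by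
  left; refine ⟨rfl, ?_⟩; unfold BStep; omega

lemma MStep_index {q : ℕ} : (4 * q + 4 + 1 = 4 * q + 4 ∧ MStep (4 * q + 4 - 1)) ∨
    (4 * q + 4 = 4 * q + 4 ∧ ¬MStep (4 * q + 4 - 1)) := by
  right; refine ⟨rfl, ?_⟩; unfold MStep; omega

lemma exists_BAngle (q : ℕ) : ∃ t, IsPatternAngle BStep (4 * q + 4) (4 * q + 3) t := by
  refine exists_isPatternAngle (by omega) BStep_index ?_
  obtain ⟨t, ht⟩ : ∃ t, t = π / (4 * ((4 * q + 4 : ℕ) : ℝ)) := ⟨_, rfl⟩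
  rw [← ht, sideExcess_eq _ (by omega) ht]
  have e : (16 * q + 16) * t = π := by rw [ht]; push_cast; field_simp; ring
  have ht0 : 0 < t := by rw [ht]; positivity
  obtain ⟨s0, s1, c0, c1, d⟩ := sin_lt_cos_bounds ht0
    (by have : (0 : ℝ) ≤ q * t := by positivity
        linarith)
  have := patternLow_BStep t q
  rw [show (8 * q + 6) * t = π / 2 - 2 * t by linarith, sin_pi_div_two_sub] at this
  set x := patternLow BStep t (4 * q + 3) 0
  have key : cos (2 * t) * (1 - 2 * cos t - 2 * x) = 2 * sin t * (1 - cos t) := by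
    rw [sin_two_mul] at this
    rw [cos_two_mul] at this ⊢
    linear_combination -this
  -- The excess is a difference of two squares. `p1` and `p2` bound `2 * x + cos t` by `1 - cos t`
  -- from above and below.
  have p1 : 0 < 1 - 2 * cos t - 2 * x := by
    refine pos_of_mul_pos_right (a := cos (2 * t)) ?_ (by linarith)
    rw [key]
    exact mul_pos (by linarith) (by linarith)
  have p2 : 0 < 2 * x + 1 := by
    refine pos_of_mul_pos_right (a := cos (2 * t)) ?_ (by linarith)
    have : cos (2 * t) * (2 * x + 1) = 2 * (1 - cos t) * (cos (2 * t) - sin t) := by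
      linear_combination -key
    rw [this]
    exact mul_pos (by linarith) (by linarith)
  nlinarith

lemma exists_MAngle (q : ℕ) : ∃ t, IsPatternAngle MStep (4 * q + 4) (4 * q + 4) t := by
  refine exists_isPatternAngle (by omega) MStep_index ?_
  obtain ⟨t, ht⟩ : ∃ t, t = π / (4 * ((4 * q + 4 : ℕ) : ℝ)) := ⟨_, rfl⟩
  rw [← ht, sideExcess_eq _ (by omega) ht]
  have e : (16 * q + 16) * t = π := by rw [ht]; push_cast; field_simp; ring
  have ht0 : 0 < t := by rw [ht]; positivity
  obtain ⟨s0, s1, c0, c1, d⟩ := sin_lt_cos_bounds ht0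
    (by have : (0 : ℝ) ≤ q * t := by positivity
        linarith)
  have := patternLow_MStep t q
  rw [show (8 * q + 6) * t = π / 2 - 2 * t by linarith,
    show (8 * q + 7) * t = π / 2 - t by linarith, sin_pi_div_two_sub, sin_pi_div_two_sub] at this
  set x := patternLow MStep t (4 * q + 4) 0
  have key : cos (2 * t) * (1 + 2 * x) =
      2 * sin t * ((2 * cos t - 1) * (1 - cos t) * (1 + 2 * cos t)) := by
    rw [sin_two_mul] at this
    rw [cos_two_mul] at this ⊢
    linear_combination this
  have hc : 1 / 2 < cos t := by nlinarith [sin_sq_add_cos_sq t]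
  have p1 : 0 < 1 + 2 * x := by
    refine pos_of_mul_pos_right (a := cos (2 * t)) ?_ (by linarith)
    rw [key]
    have : 0 < 2 * cos t - 1 := by linarith
    have : 0 < 1 - cos t := by linarith
    positivity
  have p2 : 0 < 1 - 2 * cos t - 2 * x := by
    refine pos_of_mul_pos_right (a := cos (2 * t)) ?_ (by linarith)
    have : cos (2 * t) * (1 - 2 * cos t - 2 * x) =
        2 * (1 - cos t) * (cos (2 * t) - sin t * ((2 * cos t - 1) * (1 + 2 * cos t))) := by
      linear_combination -key
    rw [this]
    have : (2 * cos t - 1) * (1 + 2 * cos t) < 3 := by nlinarith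
    exact mul_pos (by linarith) (by nlinarith)
  nlinarith

/-! ### The diameter graph -/

/-- The vertices `p` and `q` are, in some order and up to reflection, the vertex `i` and the mirror
image of the vertex `j`. -/
def Represents (h p q i j : ℕ) : Prop :=
  (p = i ∧ UnitChain.IsMirrorIndex h q j) ∨ (q = i ∧ UnitChain.IsMirrorIndex h p j) ∨
    (UnitChain.IsMirrorIndex h p i ∧ q = j) ∨ (UnitChain.IsMirrorIndex h q i ∧ p = j)

lemma UnitChain.dist_eq_one_iff {h k : ℕ} {σ : ℕ → Prop} {ℓ : ℝ} {φ : ℕ → ℝ} {v : ℕ → Plane}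
    (C : UnitChain h k σ ℓ φ v) {p q : ℕ} (hp : p < 4 * h) (hq : q < 4 * h) :
    dist (v p) (v q) = 1 ↔ ∃ i j, UnitPair h σ i j ∧ Represents h p q i j := by
  refine ⟨C.unitPair_of_dist_eq_one hp hq, ?_⟩
  have mir : ∀ {q j : ℕ}, j ≤ 2 * h → IsMirrorIndex h q j → v q = mirror (v j) := by
    rintro q j hj (e | ⟨rfl, rfl⟩)
    · rw [← C.symm j (by omega), show 2 * (2 * h) - j = q by omega]
    · rw [C.mirror_zero]
  rintro ⟨i, j, u, r⟩
  have hi : i ≤ 2 * h := by rcases u with u | u | ⟨a, ha, -, u⟩ <;> omega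
  have hj : j ≤ 2 * h := by rcases u with u | u | ⟨a, ha, -, u⟩ <;> omega
  have e := C.dist_eq_one i j u
  rcases r with ⟨rfl, r⟩ | ⟨rfl, r⟩ | ⟨r, rfl⟩ | ⟨r, rfl⟩
  · rw [mir hj r, e]
  · rw [mir hj r, dist_comm, e]
  · rw [mir hi r, dist_comm, dist_mirror_comm, e]
  · rw [mir hi r, dist_mirror_comm, e]

lemma diameterEdge_iff {q i j : ℕ} :
    DiameterEdge (16 * q) i j ↔ (i % 2 = 0 ∧ i < 8 * q ∧ i ≠ 4 * q ∧ j = i + 8 * q) ∨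
      (i % 4 = 3 ∧ i < 8 * q ∧ (j + 1 = i + 8 * q ∨ j = i + 8 * q ∨
        (j = i + 8 * q + 1 ∧ i + 8 * q + 1 < 16 * q) ∨ (i + 8 * q + 1 = 16 * q ∧ j = 0))) := by
  unfold DiameterEdge
  rw [show 16 * q / 2 = 8 * q by omega, show 16 * q / 4 = 4 * q by omega]
  have e : i < 8 * q → (i + 8 * q + 1) % (16 * q) =
      if i + 8 * q + 1 = 16 * q then 0 else i + 8 * q + 1 := by
    intro hi
    split_ifs with c
    · rw [c, Nat.mod_self]
    · exact Nat.mod_eq_of_lt (by omega)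
  by_cases hi : i < 8 * q
  · rw [e hi]
    split_ifs with c <;> omega
  · omega

lemma exists_unitPair_of_diameterEdge {q p r : ℕ} (e : DiameterEdge (16 * q) p r) :
    ∃ i j, UnitPair (4 * q) BStep i j ∧ Represents (4 * q) p r i j := by
  rw [diameterEdge_iff] at e
  unfold UnitPair Represents UnitChain.IsMirrorIndex BStep
  rcases e with ⟨e1, e2, e3, e4⟩ | ⟨e1, e2, e3 | e3 | e3⟩
  · by_cases hp : p < 4 * q
    · exact ⟨p, 8 * q - p, by omega, by omega⟩
    · exact ⟨8 * q - p, p, by omega, by omega⟩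
  · by_cases hp : p < 4 * q
    · exact ⟨p, 8 * q - (p - 1), Or.inr (Or.inr ⟨p - 1, by omega⟩), by omega⟩
    · exact ⟨8 * q - p + 1, p, Or.inr (Or.inr ⟨8 * q - p, by omega⟩), by omega⟩
  · by_cases hp : p < 4 * q
    · exact ⟨p, 8 * q - p, by omega, by omega⟩
    · exact ⟨8 * q - p, p, by omega, by omega⟩
  · by_cases hp : p < 4 * q
    · exact ⟨p, 8 * q - 1 - p, by omega, by omega⟩
    · exact ⟨8 * q - 1 - p, p, by omega, by omega⟩

lemma sub_mod_eq {n x : ℕ} (hx : x < n) : (n - x) % n = if x = 0 then 0 else n - x := by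
  split_ifs with c
  · rw [c, Nat.sub_zero, Nat.mod_self]
  · exact Nat.mod_eq_of_lt (by omega)

lemma UnitChain.IsMirrorIndex.symm {h x y : ℕ} (e : IsMirrorIndex h x y) :
    IsMirrorIndex h y x := by
  unfold IsMirrorIndex at *; omega

lemma UnitChain.IsMirrorIndex.sub_mod_eq {q x y : ℕ} (e : IsMirrorIndex (4 * q) x y)
    (hx : x < 16 * q) (hy : y < 16 * q) : (16 * q - x) % (16 * q) = y := by
  rw [_root_.sub_mod_eq hx]
  unfold IsMirrorIndex at e
  split_ifs <;> omega

lemma Represents.swap {h p q i j : ℕ} (e : Represents h p q i j) : Represents h q p i j := by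
  unfold Represents at *; tauto

lemma UnitChain.isMirrorIndex_sub_mod {q x : ℕ} (hx : x < 16 * q) :
    IsMirrorIndex (4 * q) x ((16 * q - x) % (16 * q)) := by
  rw [_root_.sub_mod_eq hx]
  unfold IsMirrorIndex
  split_ifs <;> omega

lemma UnitChain.IsMirrorIndex.eq_of_sub_mod {q x y : ℕ} (hx : x < 16 * q) (hy : y < 16 * q)
    (e : IsMirrorIndex (4 * q) ((16 * q - x) % (16 * q)) y) : x = y := by
  rw [_root_.sub_mod_eq hx] at e
  unfold IsMirrorIndex at e
  split_ifs at e <;> omega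

lemma Represents.of_mirror {q p r i j : ℕ} (hp : p < 16 * q) (hr : r < 16 * q)
    (u : UnitPair (4 * q) BStep i j)
    (e : Represents (4 * q) ((16 * q - p) % (16 * q)) ((16 * q - r) % (16 * q)) i j) :
    Represents (4 * q) p r i j := by
  have hi : i < 8 * q := by rcases u with u | u | ⟨a, ha, -, u⟩ <;> omega
  have hj : j ≤ 8 * q := by rcases u with u | u | ⟨a, ha, -, u⟩ <;> omega
  rcases e with ⟨e, f⟩ | ⟨e, f⟩ | ⟨f, e⟩ | ⟨f, e⟩
  · exact Or.inr (Or.inr (Or.inl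
      ⟨e ▸ UnitChain.isMirrorIndex_sub_mod hp, f.eq_of_sub_mod hr (by omega)⟩))
  · exact Or.inr (Or.inr (Or.inr
      ⟨e ▸ UnitChain.isMirrorIndex_sub_mod hr, f.eq_of_sub_mod hp (by omega)⟩))
  · exact Or.inl ⟨f.eq_of_sub_mod hp (by omega), e ▸ UnitChain.isMirrorIndex_sub_mod hr⟩
  · exact Or.inr (Or.inl ⟨f.eq_of_sub_mod hr (by omega), e ▸ UnitChain.isMirrorIndex_sub_mod hp⟩)

/-- For `BStep` exactly one end of a unit pair that is not antipodal is congruent to 3 modulo 4,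
since `8 * q` is divisible by 4. That end decides which alternative holds. An antipodal pair with
`i` congruent to 1 is read from its other end. -/
lemma diameterEdge_of_unitPair {q i j : ℕ} (u : UnitPair (4 * q) BStep i j) :
    DiameterEdge (16 * q) i ((16 * q - j) % (16 * q)) ∨
      DiameterEdge (16 * q) j ((16 * q - i) % (16 * q)) := by
  have hi : i < 8 * q := by rcases u with u | u | ⟨a, ha, -, u⟩ <;> omega
  have hj : 0 < j ∧ j ≤ 8 * q := by rcases u with u | u | ⟨a, ha, -, u⟩ <;> omega
  rw [sub_mod_eq (show i < 16 * q by omega), sub_mod_eq (show j < 16 * q by omega),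
    if_neg (by omega : j ≠ 0), diameterEdge_iff, diameterEdge_iff]
  unfold UnitPair BStep at u
  rcases u with u | u | ⟨a, u⟩ <;> split_ifs <;> omega

/-- The metric classification lists pairs up to reflection with an end of small index, whereas the
prescribed graph lists edges by residue and closes under reflection. The two descriptions agree once
reflection and exchange of the ends are allowed. -/
lemma diameterEdge_iff_exists_unitPair {q p r : ℕ} (hp : p < 16 * q) (hr : r < 16 * q) :
    (∃ i j, UnitPair (4 * q) BStep i j ∧ Represents (4 * q) p r i j) ↔
      p ≠ r ∧ ((DiameterEdge (16 * q) p r ∨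
          DiameterEdge (16 * q) ((16 * q - p) % (16 * q)) ((16 * q - r) % (16 * q))) ∨
        (DiameterEdge (16 * q) r p ∨
          DiameterEdge (16 * q) ((16 * q - r) % (16 * q)) ((16 * q - p) % (16 * q)))) := by
  constructor
  · rintro ⟨i, j, u, s⟩
    have hi : i < 8 * q := by rcases u with u | u | ⟨a, ha, -, u⟩ <;> omega
    have hj : j ≤ 8 * q := by rcases u with u | u | ⟨a, ha, -, u⟩ <;> omega
    have hs : i + j ≤ 8 * q + 1 ∧ 0 < j := by rcases u with u | u | ⟨a, ha, -, u⟩ <;> omega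
    have d := diameterEdge_of_unitPair u
    clear u
    have hne : p ≠ r := by
      unfold Represents UnitChain.IsMirrorIndex at s
      omega
    refine ⟨hne, ?_⟩
    rcases s with ⟨rfl, s⟩ | ⟨rfl, s⟩ | ⟨s, rfl⟩ | ⟨s, rfl⟩
    · rw [s.sub_mod_eq hr (by omega), ← s.symm.sub_mod_eq (by omega) hr]
      rw [s.symm.sub_mod_eq (by omega) hr] at d ⊢
      tauto
    · rw [s.sub_mod_eq hp (by omega), ← s.symm.sub_mod_eq (by omega) hp]
      rw [s.symm.sub_mod_eq (by omega) hp] at d ⊢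
      tauto
    · rw [s.sub_mod_eq hp (by omega), ← s.symm.sub_mod_eq (by omega) hp]
      rw [s.symm.sub_mod_eq (by omega) hp] at d ⊢
      tauto
    · rw [s.sub_mod_eq hr (by omega), ← s.symm.sub_mod_eq (by omega) hr]
      rw [s.symm.sub_mod_eq (by omega) hr] at d ⊢
      tauto
  · rintro ⟨-, (e | e) | (e | e)⟩
    · exact exists_unitPair_of_diameterEdge e
    · obtain ⟨i, j, u, s⟩ := exists_unitPair_of_diameterEdge e
      exact ⟨i, j, u, s.of_mirror hp hr u⟩
    · obtain ⟨i, j, u, s⟩ := exists_unitPair_of_diameterEdge e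
      exact ⟨i, j, u, s.swap⟩
    · obtain ⟨i, j, u, s⟩ := exists_unitPair_of_diameterEdge e
      exact ⟨i, j, u, (s.of_mirror hr hp u).swap⟩

/-! ### The polygons -/

section polygons

variable {n : ℕ}

lemma Polygon.vtx_eq [NeZero n] {P : Polygon Plane n} {v : ℕ → Plane}
    (hP : ∀ i : Fin n, P.vertices i = v i)
    (hv : v n = v 0) {i : ℕ} (hi : i ≤ n) : P.vtx i = v i := by
  rw [Polygon.vtx, hP, Fin.val_ofNat]
  rcases hi.eq_or_lt with rfl | h
  · rw [Nat.mod_self, hv]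
  · rw [Nat.mod_eq_of_lt h]

lemma angle_unitDir {t : ℝ} (h0 : 0 ≤ t) (h1 : t ≤ π) :
    EuclideanGeometry.angle (unitDir t) 0 (unitDir 0) = t := by
  have h : ∀ θ, ‖unitDir θ‖ = 1 := by
    intro θ
    rw [EuclideanSpace.norm_eq]
    simp [Fin.sum_univ_two]
  rw [EuclideanGeometry.angle, InnerProductGeometry.angle, vsub_eq_sub, vsub_eq_sub, sub_zero,
    sub_zero, h, h]
  simp [unitDir, PiLp.inner_apply, Fin.sum_univ_two, arccos_cos h0 h1]

/-- The polygon with the vertices `patternVertex`. -/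
noncomputable def patternPolygon (σ : ℕ → Prop) [DecidablePred σ] (h k : ℕ) (t : ℝ) (n : ℕ) :
    Polygon Plane n := ⟨fun i => patternVertex σ h k t i⟩

theorem isBPolygon [NeZero n] {q : ℕ} {t : ℝ} (hn : n = 16 * (q + 1))
    (H : IsPatternAngle BStep (4 * q + 4) (4 * q + 3) t) :
    IsBPolygon t (patternPolygon BStep (4 * q + 4) (4 * q + 3) t n) := by
  obtain ⟨φ, C⟩ := H.exists_unitChain
  set v := patternVertex BStep (4 * q + 4) (4 * q + 3) t with hv
  have hP : ∀ i : Fin n, (patternPolygon BStep (4 * q + 4) (4 * q + 3) t n).vertices i = v i :=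
    fun i => rfl
  have hcl : v n = v 0 := by
    rw [← C.toConvexChain.closed]; congr 1; omega
  have vtx := fun {i : ℕ} => Polygon.vtx_eq (i := i) hP hcl
  have v0 : v 0 = 0 := by
    rw [hv, IsPatternAngle.patternVertex_low _ (by omega), patternLow_zero]
    exact plane_ext (by simp) (by simp)
  have v1 : v (8 * q + 8) = unitDir 0 := by
    rw [hv, IsPatternAngle.patternVertex_high _ (by omega) (by omega),
      show 2 * (4 * q + 4) - (8 * q + 8) = 0 by omega, patternHigh, patternLow_zero]
    simp
  have v2 : v (8 * q + 7) = unitDir t := by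
    rw [hv, IsPatternAngle.patternVertex_high _ (by omega) (by omega),
      show 2 * (4 * q + 4) - (8 * q + 7) = 0 + 1 by omega,
      patternHigh_succ_of_pos (by simp [BStep]), patternLow_zero]
    simp
  refine ⟨C.isConvexEquilateralSmall (by omega) hP, ?_, ?_, ?_, ?_, ?_⟩
  · rw [vtx (by omega), v0]
  · rw [vtx (by omega), show n / 2 = 8 * q + 8 by omega, v1]
    exact plane_ext (by simp) (by simp)
  · intro i hi
    rw [vtx (by omega), vtx hi, ← C.symm i (by omega)]
    congr 1
    omega
  · ext i j
    have hi := i.isLt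
    have hj := j.isLt
    simp only [Polygon.diameterGraph, symmetricDiameterGraph, SimpleGraph.fromRel_adj]
    rw [hP, hP, C.dist_eq_one_iff (by omega) (by omega)]
    have := diameterEdge_iff_exists_unitPair (q := q + 1) (p := i) (r := j) (by omega) (by omega)
    rw [← hn] at this
    rw [show 4 * q + 4 = 4 * (q + 1) by ring, this, ne_eq, ne_eq, Fin.ext_iff]
  · rw [vtx (by omega), vtx (by omega), vtx (by omega), show n / 2 = 8 * q + 8 by omega, v0, v1,
      show 8 * q + 8 - 1 = 8 * q + 7 by omega, v2]
    refine angle_unitDir H.pos.le ?_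
    have h1 := H.lt
    have h2 := H.pos
    push_cast at h1
    nlinarith [(Nat.cast_nonneg q : (0 : ℝ) ≤ q)]

lemma cos_two_mul_pos {q : ℕ} {t : ℝ} (h0 : 0 < t) (h1 : 4 * ((4 * q + 4 : ℕ) : ℝ) * t < π) :
    0 < cos (2 * t) := by
  push_cast at h1
  have : (0 : ℝ) ≤ q * t := by positivity
  linarith [(sin_lt_cos_bounds h0 (by linarith)).2.2.2.2]

lemma sideAngleEquation {q : ℕ} {t : ℝ} (hn : n = 16 * (q + 1))
    (H : IsPatternAngle BStep (4 * q + 4) (4 * q + 3) t) : SideAngleEquation n t := by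
  have e := H.eq
  have c := cos_two_mul_pos H.pos H.lt
  have hx : patternLow BStep t (4 * q + 3) 0 = sin t - (2 * cos t - 1) *
      (sin (2 * t) + sin ((n / 2 - 2) * t)) / (2 * cos (2 * t)) := by
    have := patternLow_BStep t q
    rw [hn, show ((16 * (q + 1) : ℕ) : ℝ) / 2 - 2 = 8 * q + 6 by push_cast; ring]
    have c' : 2 * cos (2 * t) ≠ 0 := by positivity
    have h3 : (2 * cos t - 1) * (sin (2 * t) + sin ((8 * q + 6) * t)) / (2 * cos (2 * t)) =
        sin t - patternLow BStep t (4 * q + 3) 0 := by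
      rw [div_eq_iff c']
      linarith
    linarith
  rw [SideAngleEquation, ← hx, hn,
    show ((16 * (q + 1) : ℕ) : ℝ) / 2 - 1 = 2 * ((4 * q + 4 : ℕ) : ℝ) - 1 by push_cast; ring]
  exact e

lemma patternLow_MStep_eq (t : ℝ) (a : ℕ) : patternLow MStep t a = mossinghoffLow t a := by
  unfold patternLow mossinghoffLow
  refine Finset.sum_congr rfl fun j _ => ?_
  unfold patternStep mossinghoffStep MStep
  congr 1

lemma patternVertex_MStep_eq {q n : ℕ} (hn : n = 16 * (q + 1)) (t : ℝ) (i : ℕ) :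
    patternVertex MStep (4 * q + 4) (4 * q + 4) t i = mossinghoffVertex n t i := by
  unfold patternVertex mossinghoffVertex
  simp only [patternHigh, mossinghoffHigh, patternLow_MStep_eq]
  rw [show n / 4 = 4 * q + 4 by omega, show n / 2 = 2 * (4 * q + 4) by omega,
    show 3 * n / 4 = 4 * (4 * q + 4) - (4 * q + 4) by omega, show n = 4 * (4 * q + 4) by omega]

theorem exists_isMossinghoffPolygon {q : ℕ} (hn : n = 16 * (q + 1)) :
    ∃ M : Polygon Plane n, IsMossinghoffPolygon M := by
  obtain ⟨t, H⟩ := exists_MAngle q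
  obtain ⟨φ, C⟩ := H.exists_unitChain
  refine ⟨patternPolygon MStep (4 * q + 4) (4 * q + 4) t n,
    C.isConvexEquilateralSmall (by omega) fun i => rfl, t, ⟨H.pos, ?_⟩, fun i => ?_⟩
  · have := H.lt
    rw [hn, lt_div_iff₀ (by positivity)]
    push_cast at this ⊢
    linarith
  · exact patternVertex_MStep_eq hn t i

lemma dist_patternVertex_succ {σ : ℕ → Prop} [DecidablePred σ] {h k : ℕ} {t : ℝ} {i : ℕ}
    (hi : i < k) (ht : 0 ≤ sin (t / 2)) :
    dist (patternVertex σ h k t i) (patternVertex σ h k t (i + 1)) = 2 * sin (t / 2) := by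
  rw [IsPatternAngle.patternVertex_low _ hi.le, IsPatternAngle.patternVertex_low _ hi, dist_mirror,
    patternLow_succ]
  apply dist_eq_of_sq (by positivity)
  rw [PiLp.add_apply, PiLp.add_apply, patternStep_fst, patternStep_snd]
  linear_combination (2 * sin (t / 2)) ^ 2 * sin_sq_add_cos_sq (lowAngle σ t i)

/-- The sides of a Mossinghoff polygon. -/
theorem IsMossinghoffPolygon.exists_angle {q : ℕ} (hn : n = 16 * (q + 1)) {M : Polygon Plane n}
    (hM : IsMossinghoffPolygon M) : ∃ t, IsPatternAngle MStep (4 * q + 4) (4 * q + 4) t ∧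
      M.perimeter = n * (2 * sin (t / 2)) := by
  obtain ⟨hc, t, ⟨t0, t1⟩, hv⟩ := hM
  obtain ⟨c, hc⟩ := hc.equilateral
  have hlt : 4 * ((4 * q + 4 : ℕ) : ℝ) * t < π := by
    rw [hn, lt_div_iff₀ (by positivity)] at t1
    push_cast at t1 ⊢
    linarith
  have hlt' : t < π := by
    push_cast at hlt
    have : (0 : ℝ) ≤ q * t := by positivity
    linarith
  have st : 0 < sin (t / 2) := sin_pos_of_pos_of_lt_pi (by linarith) (by linarith)
  have side : ∀ i, i + 1 < n → dist (patternVertex MStep (4 * q + 4) (4 * q + 4) t i)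
      (patternVertex MStep (4 * q + 4) (4 * q + 4) t (i + 1)) = c := by
    intro i hi
    have := hc ⟨i, by omega⟩
    rw [hv, hv, val_finRotate (by omega), if_neg (by simpa using hi.ne)] at this
    rwa [patternVertex_MStep_eq hn, patternVertex_MStep_eq hn]
  -- The side at `v 0` has this length for every `t`, so it fixes the common length; the side at
  -- `v_{n/4}` then yields the equation for `t`. Uniqueness of `t` is not needed.
  have ec : c = 2 * sin (t / 2) := by
    rw [← side 0 (by omega), dist_patternVertex_succ (by omega) st.le]
  refine ⟨t, ⟨by omega, MStep_index, t0, hlt, ?_⟩, ?_⟩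
  · have e := side (4 * q + 4) (by omega)
    have e' := patternHigh_eq_of_neg (σ := MStep) (t := t) (a := 4 * q + 3)
      (by unfold MStep; omega)
    rw [IsPatternAngle.patternVertex_low _ le_rfl,
      IsPatternAngle.patternVertex_high _ (by omega) (by omega),
      show 2 * (4 * q + 4) - (4 * q + 4 + 1) = 4 * q + 3 by omega, e', ec] at e
    have e2 := plane_dist_sq (mirror (patternLow MStep t (4 * q + 4)))
      (patternLow MStep t (4 * q + 3 + 1) + unitDir ((2 * (4 * q + 3 : ℕ) + 1) * t))
    rw [e] at e2
    simp only [PiLp.add_apply, mirror_fst, mirror_snd, unitDir_fst, unitDir_snd] at e2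
    rw [show (2 * ((4 * q + 3 : ℕ) : ℝ) + 1) = 2 * ((4 * q + 4 : ℕ) : ℝ) - 1 by push_cast; ring]
      at e2
    linarith
  · rw [Polygon.perimeter_eq_of_sides hc, ec]

theorem perimeter_BPolygon {q : ℕ} {t : ℝ} (hn : n = 16 * (q + 1))
    (H : IsPatternAngle BStep (4 * q + 4) (4 * q + 3) t) :
    (patternPolygon BStep (4 * q + 4) (4 * q + 3) t n).perimeter = n * (2 * sin (t / 2)) := by
  obtain ⟨φ, C⟩ := H.exists_unitChain
  exact Polygon.perimeter_eq_of_sides (C.dist_finRotate (by omega) fun i => rfl)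

end polygons

/-! ### Bounded functions -/

/-- The function `f` is bounded. -/
@[fun_prop]
def Bdd {α : Type*} (f : α → ℝ) : Prop := ∃ C, ∀ a, |f a| ≤ C

namespace Bdd

variable {α : Type*} {f g : α → ℝ}

@[fun_prop]
lemma const (c : ℝ) : Bdd fun _ : α => c := ⟨|c|, fun _ => le_rfl⟩

@[fun_prop]
lemma add (hf : Bdd f) (hg : Bdd g) : Bdd fun a => f a + g a := by
  obtain ⟨C, hC⟩ := hf
  obtain ⟨D, hD⟩ := hg
  exact ⟨C + D, fun a => (abs_add_le _ _).trans (add_le_add (hC a) (hD a))⟩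

@[fun_prop]
lemma neg (hf : Bdd f) : Bdd fun a => -f a := by
  obtain ⟨C, hC⟩ := hf
  exact ⟨C, fun a => by rw [abs_neg]; exact hC a⟩

@[fun_prop]
lemma sub (hf : Bdd f) (hg : Bdd g) : Bdd fun a => f a - g a := by
  simpa only [sub_eq_add_neg] using hf.add hg.neg

@[fun_prop]
lemma mul (hf : Bdd f) (hg : Bdd g) : Bdd fun a => f a * g a := by
  obtain ⟨C, hC⟩ := hf
  obtain ⟨D, hD⟩ := hg
  refine ⟨C * D, fun a => ?_⟩
  rw [abs_mul]
  exact mul_le_mul (hC a) (hD a) (abs_nonneg _) ((abs_nonneg _).trans (hC a))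

@[fun_prop]
lemma div_const (hf : Bdd f) (c : ℝ) : Bdd fun a => f a / c := by
  simpa only [div_eq_mul_inv] using hf.mul (const c⁻¹)

@[fun_prop]
lemma pow (hf : Bdd f) (k : ℕ) : Bdd fun a => f a ^ k := by
  induction k with
  | zero => simpa using const 1
  | succ k ih => simpa only [pow_succ] using ih.mul hf

lemma of_le (C : ℝ) (h : ∀ a, |f a| ≤ C) : Bdd f := ⟨C, h⟩

lemma exists_eq_mul (C : ℝ) (hg : ∀ a, 0 < g a) (h : ∀ a, |f a| ≤ C * g a) :
    ∃ r, Bdd r ∧ ∀ a, f a = g a * r a := by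
  refine ⟨fun a => f a / g a, ⟨C, fun a => ?_⟩, fun a => ?_⟩
  · rw [abs_div, abs_of_pos (hg a), div_le_iff₀ (hg a)]
    exact h a
  · have := (hg a).ne'
    field_simp

lemma exists_sin_eq (hf : ∀ a, 0 < f a) (hf' : ∀ a, f a ≤ 1) :
    ∃ r, Bdd r ∧ ∀ a, sin (f a) = f a - f a ^ 3 / 6 + f a ^ 5 * r a := by
  obtain ⟨r, hr, e⟩ := exists_eq_mul (f := fun a => sin (f a) - (f a - f a ^ 3 / 6))
    (g := fun a => f a ^ 5) (1 / 100) (fun a => pow_pos (hf a) 5) (fun a => by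
      have := sin_bound (x := f a) (by rw [abs_of_pos (hf a)]; exact hf' a)
      rw [abs_of_pos (hf a)] at this
      linarith)
  exact ⟨r, hr, fun a => by linarith [e a]⟩

lemma exists_cos_eq (hf : ∀ a, 0 < f a) (hf' : ∀ a, f a ≤ 1) :
    ∃ r, Bdd r ∧ ∀ a, cos (f a) = 1 - f a ^ 2 / 2 + f a ^ 4 * r a := by
  obtain ⟨r, hr, e⟩ := exists_eq_mul (f := fun a => cos (f a) - (1 - f a ^ 2 / 2))
    (g := fun a => f a ^ 4) (5 / 96) (fun a => pow_pos (hf a) 4) (fun a => by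
      have := cos_bound (x := f a) (by rw [abs_of_pos (hf a)]; exact hf' a)
      rw [abs_of_pos (hf a)] at this
      linarith)
  exact ⟨r, hr, fun a => by linarith [e a]⟩

/-- Squaring the sine expansion at half the angle, in cos x = 1 - 2 sin²(x/2), gives the cosine up
to sixth order. -/
lemma exists_cos_eq' (hf : ∀ a, 0 < f a) (hf' : ∀ a, f a ≤ 1) :
    ∃ r, Bdd r ∧ ∀ a, cos (f a) = 1 - f a ^ 2 / 2 + f a ^ 4 / 24 + f a ^ 6 * r a := by
  obtain ⟨r, hr, e⟩ := exists_sin_eq (f := fun a => f a / 2) (fun a => half_pos (hf a))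
    (fun a => by linarith [hf a, hf' a])
  have hb : Bdd f := of_le 1 fun a => by rw [abs_of_pos (hf a)]; exact hf' a
  refine ⟨fun a => -2 * ((1 / 48) ^ 2 + r a / 32 - f a ^ 2 * r a / 768 + f a ^ 4 * r a ^ 2 / 1024),
    by fun_prop, fun a => ?_⟩
  · have h := cos_two_mul (f a / 2)
    rw [show 2 * (f a / 2) = f a by ring] at h
    have h2 := sin_sq_add_cos_sq (f a / 2)
    have h3 : cos (f a) = 1 - 2 * sin (f a / 2) ^ 2 := by linarith
    rw [h3, e a]
    ring

lemma inv {c : ℝ} (hc : 0 < c) (h : ∀ a, c ≤ f a) : Bdd fun a => (f a)⁻¹ :=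
  of_le c⁻¹ fun a => by
    rw [abs_of_pos (inv_pos.2 (hc.trans_le (h a)))]
    exact inv_anti₀ hc (h a)

end Bdd

/-! ### The size of the defect -/

/-- An a priori bound of the true order t⁴, for both polygons at once, since the bound on `E`
includes the additional term of M. It is obtained in two rounds: η = O(t³) without using the size of
`E`, then E = O(t³) and hence η = O(t⁴). -/
lemma defect_le_aux {t η E : ℝ} (t0 : 0 < t) (t1 : t ≤ 1 / 5) (η0 : 0 < η) (η1 : η < t / 2)
    (E0 : 0 ≤ E)
    (hE : E ≤ (1 - cos η) + 2 * sin t * (1 - cos t) * (1 - sin η) / cos (2 * t)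
      + 4 * sin t * (1 - cos t))
    (e : 2 * (cos t - cos (t + η)) = E * (2 * (1 - cos (t + η)) - E)) : η ≤ 18 * t ^ 4 := by
  have half : ∀ x : ℝ, 0 < x → x ≤ 1 → x / 2 ≤ sin x := by
    intro x h0 h1
    have := sin_gt_sub_cube h0
    have h2 : x ^ 3 ≤ x := by nlinarith [mul_nonneg h0.le h0.le]
    linarith
  have hs := half t t0 (by linarith)
  have hσ := half η η0 (by linarith)
  have low : t * η / 2 ≤ 2 * (cos t - cos (t + η)) := by
    rw [cos_add]
    have c0 : 0 ≤ cos t := (cos_pos_of_le_one (by rw [abs_of_pos t0]; linarith)).le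
    have h1 := mul_nonneg c0 (sub_nonneg.2 (cos_le_one η))
    have h2 := mul_le_mul hs hσ (by linarith) (by linarith)
    linarith
  have C1 : 1 - cos (t + η) ≤ 9 / 8 * t ^ 2 := by
    have := one_sub_sq_div_two_le_cos (x := t + η)
    nlinarith
  have C0 : 0 ≤ 1 - cos (t + η) := by linarith [cos_le_one (t + η)]
  -- With C = 1 - cos(t+η), the product E(2C - E) is at most C² for every E.
  have b3 : η ≤ 4 * t ^ 3 := by
    have h1 : E * (2 * (1 - cos (t + η)) - E) ≤ (1 - cos (t + η)) ^ 2 := by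
      nlinarith [sq_nonneg (1 - cos (t + η) - E)]
    have h2 : (1 - cos (t + η)) ^ 2 ≤ (9 / 8 * t ^ 2) ^ 2 := by gcongr
    have h3 : 0 ≤ t ^ 4 := by positivity
    have : t * η ≤ t * (4 * t ^ 3) := by linarith
    exact le_of_mul_le_mul_left this t0
  have s1 : sin t ≤ t := sin_le t0.le
  have c1 : 1 - cos t ≤ t ^ 2 / 2 := by linarith [one_sub_sq_div_two_le_cos (x := t)]
  have c0 : 0 ≤ 1 - cos t := by linarith [cos_le_one t]
  have c2 : 9 / 10 ≤ cos (2 * t) := by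
    have := one_sub_sq_div_two_le_cos (x := 2 * t)
    nlinarith
  have sc : sin t * (1 - cos t) ≤ t ^ 3 / 2 := by
    have := mul_le_mul s1 c1 c0 t0.le
    linarith
  have sc0 : 0 ≤ sin t * (1 - cos t) := mul_nonneg (by linarith) c0
  have q : 2 * sin t * (1 - cos t) * (1 - sin η) / cos (2 * t) ≤ 10 / 9 * t ^ 3 := by
    rw [div_le_iff₀ (by linarith)]
    have h1 : sin t * (1 - cos t) * (1 - sin η) ≤ sin t * (1 - cos t) * 1 :=
      mul_le_mul_of_nonneg_left (by linarith) sc0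
    have h2 : t ^ 3 * (9 / 10) ≤ t ^ 3 * cos (2 * t) := by gcongr
    linarith
  have g : 1 - cos η ≤ 8 * t ^ 6 := by
    have h1 := one_sub_sq_div_two_le_cos (x := η)
    have h2 : η ^ 2 ≤ (4 * t ^ 3) ^ 2 := by gcongr
    linarith
  have E1 : E ≤ 4 * t ^ 3 := by
    have h1 : t ^ 6 ≤ t ^ 3 * (1 / 5) ^ 3 := by
      rw [show t ^ 6 = t ^ 3 * t ^ 3 by ring]; gcongr
    have h2 : 0 ≤ t ^ 3 := by positivity
    linarith
  have h1 : E * (2 * (1 - cos (t + η)) - E) ≤ 4 * t ^ 3 * (9 / 4 * t ^ 2) := by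
    calc E * (2 * (1 - cos (t + η)) - E) ≤ E * (9 / 4 * t ^ 2) := by gcongr; linarith
      _ ≤ 4 * t ^ 3 * (9 / 4 * t ^ 2) := by gcongr
  have : t * η ≤ t * (18 * t ^ 4) := by linarith
  exact le_of_mul_le_mul_left this t0

/-! ### The expansion of the defect -/

section expansion

variable {α : Type*} {t η κ : α → ℝ}

/-- The product of two expansions to second order. -/
lemma expansion_mul {x r s : α → ℝ} {p q : ℝ} (hx : Bdd x) (hr : Bdd r) (hs : Bdd s) :
    ∃ u, Bdd u ∧ ∀ a, (1 + p * x a + x a ^ 2 * r a) * (1 + q * x a + x a ^ 2 * s a) =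
      1 + (p + q) * x a + x a ^ 2 * u a :=
  ⟨fun a => p * q + r a + s a + x a * (p * s a + q * r a) + x a ^ 2 * (r a * s a), by fun_prop,
    fun a => by ring⟩

/-- These four quantities make up the defect equation of both polygons. In the third one the
relative coefficients of t² are -1/6 from sin t, -1/12 from 1 - cos t and 2 from 1/cos 2t, with sum
7/4; sin η enters only at relative order t⁴. -/
lemma expansion_basic (t0 : ∀ a, 0 < t a) (t1 : ∀ a, t a ≤ 1 / 5) (η0 : ∀ a, 0 < η a)
    (η1 : ∀ a, η a ≤ t a) (hκ : Bdd κ) (e : ∀ a, η a = κ a * t a ^ 4) :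
    (∃ r, Bdd r ∧ ∀ a, 2 * (cos (t a) - cos (t a + η a)) = t a ^ 5 *
      (2 * κ a * (1 - t a ^ 2 / 6) + κ a ^ 2 * t a ^ 3 + t a ^ 4 * r a)) ∧
    (∃ r, Bdd r ∧ ∀ a, 2 * (1 - cos (t a + η a)) = t a ^ 2 *
      (1 - t a ^ 2 / 12 + 2 * κ a * t a ^ 3 + t a ^ 4 * r a)) ∧
    (∃ r, Bdd r ∧ ∀ a, (1 - cos (η a))
        + 2 * sin (t a) * (1 - cos (t a)) * (1 - sin (η a)) / cos (2 * t a) =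
      t a ^ 3 * (1 + 7 / 4 * t a ^ 2 + t a ^ 4 * r a)) ∧
    ∃ r, Bdd r ∧ ∀ a, 4 * sin (t a) * (1 - cos (t a)) = t a ^ 3 * (2 + t a * r a) := by
  have hb : Bdd t := Bdd.of_le 1 fun a => by rw [abs_of_pos (t0 a)]; linarith [t1 a]
  obtain ⟨b, hb1, eb⟩ := Bdd.exists_sin_eq t0 (fun a => by linarith [t1 a])
  obtain ⟨c, hc, ec⟩ := Bdd.exists_cos_eq' t0 (fun a => by linarith [t1 a])
  obtain ⟨g, hg, eg⟩ := Bdd.exists_cos_eq η0 (fun a => by linarith [t1 a, η1 a])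
  obtain ⟨d, hd, ed⟩ := Bdd.exists_sin_eq η0 (fun a => by linarith [t1 a, η1 a])
  obtain ⟨f, hf, ef⟩ := Bdd.exists_cos_eq (f := fun a => 2 * t a) (fun a => by linarith [t0 a])
    (fun a => by linarith [t1 a])
  have hcos : ∀ a, 9 / 10 ≤ cos (2 * t a) := fun a => by
    have := one_sub_sq_div_two_le_cos (x := 2 * t a)
    nlinarith [t0 a, t1 a]
  have hct : Bdd fun a => cos (t a) := Bdd.of_le 1 fun a => abs_cos_le_one _
  have hinv := Bdd.inv (f := fun a => cos (2 * t a)) (by norm_num : (0 : ℝ) < 9 / 10) hcos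
  obtain ⟨G, hG, eG⟩ : ∃ G, Bdd G ∧ ∀ a, cos (η a) = 1 - κ a ^ 2 * t a ^ 8 / 2 + t a ^ 9 * G a :=
    ⟨fun a => κ a ^ 4 * t a ^ 7 * g a, by fun_prop, fun a => by rw [eg, e]; ring⟩
  obtain ⟨S, hS, eS⟩ : ∃ S, Bdd S ∧ ∀ a, sin (η a) = κ a * t a ^ 4 + t a ^ 8 * S a :=
    ⟨fun a => -κ a ^ 3 * t a ^ 4 / 6 + κ a ^ 5 * t a ^ 12 * d a, by fun_prop,
      fun a => by rw [ed, e]; ring⟩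
  obtain ⟨F, hF, eF⟩ : ∃ F, Bdd F ∧ ∀ a, (cos (2 * t a))⁻¹ = 1 + 2 * t a ^ 2 + t a ^ 4 * F a := by
    refine ⟨fun a => (cos (2 * t a))⁻¹ * (4 - 16 * f a * (1 + 2 * t a ^ 2)), by fun_prop,
      fun a => ?_⟩
    have : cos (2 * t a) ≠ 0 := by linarith [hcos a]
    field_simp
    rw [ef]; ring
  obtain ⟨A, hA, eA⟩ := expansion_mul (x := fun a => t a ^ 2) (p := -1 / 6) (q := -1 / 12) (r := b)
    (s := fun a => -2 * c a) (by fun_prop) hb1 (by fun_prop)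
  obtain ⟨D, hD, eD⟩ := expansion_mul (x := fun a => t a ^ 2) (p := 2) (q := 0) (r := F)
    (s := fun a => -κ a - t a ^ 4 * S a) (by fun_prop) hF (by fun_prop)
  obtain ⟨H, hH, eH⟩ := expansion_mul (x := fun a => t a ^ 2) (p := -1 / 6 + -1 / 12) (q := 2 + 0)
    (r := A) (s := D) (by fun_prop) hA hD
  refine ⟨⟨fun a => t a * (-1 / 2 + t a ^ 2 / 24 + t a ^ 4 * c a) * κ a ^ 2 - 2 * cos (t a) * G a
      + 2 * b a * κ a + 2 * (1 - t a ^ 2 / 6 + t a ^ 4 * b a) * S a, by fun_prop, fun a => ?_⟩,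
    ⟨fun a => -2 * c a + cos (t a) * (κ a ^ 2 * t a ^ 2 - 2 * t a ^ 3 * G a)
      + 2 * κ a * t a * (-1 / 6 + t a ^ 2 * b a) + 2 * (1 - t a ^ 2 / 6 + t a ^ 4 * b a)
        * t a ^ 3 * S a, by fun_prop, fun a => ?_⟩,
    ⟨fun a => H a + κ a ^ 2 * t a / 2 - t a ^ 2 * G a, by fun_prop, fun a => ?_⟩,
    ⟨fun a => 2 * (-t a / 4 + t a ^ 3 * A a), by fun_prop, fun a => ?_⟩⟩
  · rw [cos_add, eG, eS, eb]
    linear_combination (t a ^ 8 * κ a ^ 2) * ec a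
  · rw [cos_add, eG, eS, eb]
    linear_combination (-2) * ec a
  · rw [div_eq_mul_inv, eF, eG, eS, eb, ec]
    linear_combination t a ^ 3 * (1 - t a ^ 2 / 6 + t a ^ 4 * b a)
      * (1 - t a ^ 2 / 12 - 2 * t a ^ 4 * c a) * eD a + t a ^ 3 * eH a
      + t a ^ 3 * (1 + (2 + 0) * t a ^ 2 + t a ^ 4 * D a) * eA a
  · rw [eb, ec]
    linear_combination 2 * t a ^ 3 * eA a

/-- The defect of the polygon `B`. -/
theorem expansion_B (t0 : ∀ a, 0 < t a) (t1 : ∀ a, t a ≤ 1 / 5) (η0 : ∀ a, 0 < η a)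
    (η1 : ∀ a, η a ≤ t a) (hκ : Bdd κ) (e : ∀ a, η a = κ a * t a ^ 4) {E : α → ℝ}
    (hE : ∀ a, E a = (1 - cos (η a))
      + 2 * sin (t a) * (1 - cos (t a)) * (1 - sin (η a)) / cos (2 * t a))
    (heq : ∀ a, 2 * (cos (t a) - cos (t a + η a)) = E a * (2 * (1 - cos (t a + η a)) - E a)) :
    ∃ k, Bdd k ∧ ∀ a, κ a = 1 / 2 - t a / 2 + 11 / 12 * t a ^ 2 - 35 / 24 * t a ^ 3
      + t a ^ 4 * k a := by
  have hb : Bdd t := Bdd.of_le 1 fun a => by rw [abs_of_pos (t0 a)]; linarith [t1 a]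
  obtain ⟨⟨l, hl, el⟩, ⟨m, hm, em⟩, ⟨r, hr, er⟩, -⟩ := expansion_basic t0 t1 η0 η1 hκ e
  -- Chosen so that (2(1 - cos(t+η)) - E)/t² = 1 + t(-1 + ty).
  obtain ⟨y, hy, ey⟩ : ∃ y, Bdd y ∧
      ∀ a, y a = -1 / 12 + (2 * κ a - 7 / 4) * t a + t a ^ 2 * (m a - t a * r a) :=
    ⟨_, by fun_prop, fun a => rfl⟩
  have key : ∀ a, 2 * κ a * (1 - t a ^ 2 / 6) + κ a ^ 2 * t a ^ 3 + t a ^ 4 * l a =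
      (1 + 7 / 4 * t a ^ 2 + t a ^ 4 * r a) * (1 + t a * (-1 + t a * y a)) := by
    intro a
    have h := heq a
    rw [el, em, hE, er] at h
    refine mul_left_cancel₀ (pow_ne_zero 5 (t0 a).ne') ?_
    rw [h, ey]
    ring
  -- The coefficients of `κ` are found one at a time. In `key` every further occurrence of `κ`
  -- carries a positive power of `t`, so what is already known determines the next coefficient and
  -- an explicit bounded remainder.
  obtain ⟨k1, hk1, ek1⟩ : ∃ k, Bdd k ∧ ∀ a, κ a = 1 / 2 + t a * k a :=
    ⟨fun a => 1 / 2 * (κ a * t a / 3 - κ a ^ 2 * t a ^ 2 - t a ^ 3 * l a + (-1 + t a * y a)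
      + (7 / 4 * t a + t a ^ 3 * r a) * (1 + t a * (-1 + t a * y a))), by fun_prop,
      fun a => by linear_combination 1 / 2 * key a⟩
  obtain ⟨k2, hk2, ek2⟩ : ∃ k, Bdd k ∧ ∀ a, k1 a = -1 / 2 + t a * k a := by
    refine ⟨fun a => 1 / 2 * (κ a / 3 - κ a ^ 2 * t a - t a ^ 2 * l a + y a
      + (7 / 4 + t a ^ 2 * r a) * (1 + t a * (-1 + t a * y a))), by fun_prop, fun a => ?_⟩
    refine mul_left_cancel₀ (t0 a).ne' ?_
    linear_combination 1 / 2 * key a - ek1 a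
  obtain ⟨k3, hk3, ek3⟩ : ∃ k, Bdd k ∧ ∀ a, k2 a = 11 / 12 + t a * k a := by
    refine ⟨fun a => 1 / 2 * (k1 a / 3 - κ a ^ 2 - t a * l a + (2 * κ a - 7 / 4)
      + t a * (m a - t a * r a) + 7 / 4 * (-1 + t a * y a)
      + t a * r a * (1 + t a * (-1 + t a * y a))), by fun_prop, fun a => ?_⟩
    refine mul_left_cancel₀ (pow_ne_zero 2 (t0 a).ne') ?_
    linear_combination 1 / 2 * key a - ek1 a - t a * ek2 a + t a ^ 2 / 6 * ek1 a
      + 1 / 2 * t a ^ 2 * ey a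
  obtain ⟨k4, hk4, ek4⟩ : ∃ k, Bdd k ∧ ∀ a, k3 a = -35 / 24 + t a * k a := by
    refine ⟨fun a => 1 / 2 * (k2 a / 3 - (k1 a + t a * k1 a ^ 2) - l a + 2 * k1 a
      + (m a - t a * r a) + 7 / 4 * y a
      + r a * (1 + t a * (-1 + t a * y a))), by fun_prop, fun a => ?_⟩
    refine mul_left_cancel₀ (pow_ne_zero 3 (t0 a).ne') ?_
    -- The last multiple of `ek1` replaces `κ` inside `y` by its first-order form, and `κ ^ 2` by
    -- the square of that form.
    linear_combination 1 / 2 * key a - ek1 a - t a * ek2 a - t a ^ 2 * ek3 a + t a ^ 2 / 6 * ek1 a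
      + t a ^ 3 / 6 * ek2 a + 1 / 2 * t a ^ 2 * ey a
      + t a ^ 3 * (1 - (κ a + 1 / 2 + t a * k1 a) / 2) * ek1 a
  exact ⟨k4, hk4, fun a => by rw [ek1, ek2, ek3, ek4]; ring⟩

/-- The defect of Mossinghoff's polygon. -/
theorem expansion_M (t0 : ∀ a, 0 < t a) (t1 : ∀ a, t a ≤ 1 / 5) (η0 : ∀ a, 0 < η a)
    (η1 : ∀ a, η a ≤ t a) (hκ : Bdd κ) (e : ∀ a, η a = κ a * t a ^ 4) {E : α → ℝ}
    (hE : ∀ a, E a = (1 - cos (η a))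
      + 2 * sin (t a) * (1 - cos (t a)) * (1 - sin (η a)) / cos (2 * t a)
      + 4 * sin (t a) * (1 - cos (t a)))
    (heq : ∀ a, 2 * (cos (t a) - cos (t a + η a)) = E a * (2 * (1 - cos (t a + η a)) - E a)) :
    ∃ k, Bdd k ∧ ∀ a, κ a = 3 / 2 + t a * k a := by
  have hb : Bdd t := Bdd.of_le 1 fun a => by rw [abs_of_pos (t0 a)]; linarith [t1 a]
  obtain ⟨⟨l, hl, el⟩, ⟨m, hm, em⟩, ⟨r, hr, er⟩, ⟨p, hp, ep⟩⟩ := expansion_basic t0 t1 η0 η1 hκ e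
  obtain ⟨x, hx, ex⟩ : ∃ x, Bdd x ∧ ∀ a, x a = 7 / 4 * t a + t a ^ 3 * r a + p a :=
    ⟨_, by fun_prop, fun a => rfl⟩
  obtain ⟨y, hy, ey⟩ : ∃ y, Bdd y ∧ ∀ a, y a = -t a / 12 + 2 * κ a * t a ^ 2 + t a ^ 3 * m a
      - (3 + t a * x a) := ⟨_, by fun_prop, fun a => rfl⟩
  have key : ∀ a, 2 * κ a * (1 - t a ^ 2 / 6) + κ a ^ 2 * t a ^ 3 + t a ^ 4 * l a =
      (3 + t a * x a) * (1 + t a * y a) := by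
    intro a
    have h := heq a
    rw [el, em, hE, er, ep] at h
    refine mul_left_cancel₀ (pow_ne_zero 5 (t0 a).ne') ?_
    rw [h, ey, ex]
    ring
  exact ⟨fun a => 1 / 2 * (κ a * t a / 3 - κ a ^ 2 * t a ^ 2 - t a ^ 3 * l a + x a
    + (3 + t a * x a) * y a), by fun_prop, fun a => by linear_combination 1 / 2 * key a⟩

end expansion

/-! ### The defects of the two polygons -/

section defect

variable {q : ℕ} {t η : ℝ}

lemma defect_bounds {σ : ℕ → Prop} [DecidablePred σ] {k : ℕ}
    (H : IsPatternAngle σ (4 * q + 4) k t) (hη : η = π / 2 - 2 * ((4 * q + 4 : ℕ) : ℝ) * t) :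
    0 < t ∧ t ≤ 1 / 5 ∧ 0 < η ∧ η < t / 2 := by
  have h1 := H.half_pi_sub_lt
  rw [← hη] at h1
  have h2 := H.lt
  have h3 := H.pos
  push_cast at h2 hη
  have : (0 : ℝ) ≤ q * t := by positivity
  exact ⟨h3, by linarith [pi_lt_d2], by linarith, h1⟩

/-- The quantity `(1 - cos (t + η)) - δ`, where `δ` is the horizontal extent of the exceptional side
of `B`. -/
lemma defect_B (H : IsPatternAngle BStep (4 * q + 4) (4 * q + 3) t)
    (hη : η = π / 2 - 2 * ((4 * q + 4 : ℕ) : ℝ) * t) :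
    ∃ E, E = (1 - cos η) + 2 * sin t * (1 - cos t) * (1 - sin η) / cos (2 * t) ∧
      2 * (cos t - cos (t + η)) = E * (2 * (1 - cos (t + η)) - E) := by
  have c := cos_two_mul_pos H.pos H.lt
  have e := H.eq_of_fst hη
  have x := patternLow_BStep t q
  rw [show (8 * q + 6) * t = π / 2 - (2 * t + η) by rw [hη]; push_cast; ring,
    sin_pi_div_two_sub] at x
  refine ⟨1 - cos (t + η) - (2 * patternLow BStep t (4 * q + 3) 0 + cos (t + η)), ?_, ?_⟩
  · rw [← sub_eq_iff_eq_add', eq_div_iff c.ne']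
    rw [cos_add] at x ⊢
    rw [sin_two_mul] at x
    rw [cos_two_mul] at x ⊢
    linear_combination -x
  · linear_combination e

/-- The quantity `(1 - cos (t + η)) + δ` for Mossinghoff's polygon. -/
lemma defect_M (H : IsPatternAngle MStep (4 * q + 4) (4 * q + 4) t)
    (hη : η = π / 2 - 2 * ((4 * q + 4 : ℕ) : ℝ) * t) :
    ∃ E, E = (1 - cos η) + 2 * sin t * (1 - cos t) * (1 - sin η) / cos (2 * t)
        + 4 * sin t * (1 - cos t) ∧
      2 * (cos t - cos (t + η)) = E * (2 * (1 - cos (t + η)) - E) := by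
  have c := cos_two_mul_pos H.pos H.lt
  have e := H.eq_of_fst hη
  have x := patternLow_MStep t q
  rw [show (8 * q + 6) * t = π / 2 - (2 * t + η) by rw [hη]; push_cast; ring,
    show (8 * q + 7) * t = π / 2 - (t + η) by rw [hη]; push_cast; ring,
    sin_pi_div_two_sub, sin_pi_div_two_sub] at x
  refine ⟨1 - cos (t + η) + (2 * patternLow MStep t (4 * q + 4) 0 + cos (t + η)), ?_, ?_⟩
  · rw [← sub_eq_iff_eq_add, ← sub_eq_iff_eq_add', eq_div_iff c.ne']
    rw [cos_add, cos_add] at x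
    rw [sin_two_mul] at x
    rw [cos_two_mul] at x ⊢
    linear_combination x
  · linear_combination e

lemma defect_nonneg (t0 : 0 < t) (t1 : t ≤ 1 / 5) :
    0 ≤ (1 - cos η) + 2 * sin t * (1 - cos t) * (1 - sin η) / cos (2 * t) ∧
      0 ≤ 4 * sin t * (1 - cos t) := by
  have hs : 0 ≤ sin t := (sin_pos_of_pos_of_le_one t0 (by linarith)).le
  have hc : 0 ≤ 1 - cos t := by linarith [cos_le_one t]
  have h1 : 0 ≤ 1 - cos η := by linarith [cos_le_one η]
  have h2 : 0 ≤ 1 - sin η := by linarith [sin_le_one η]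
  have h3 : 0 ≤ cos (2 * t) :=
    (cos_pos_of_le_one (by rw [abs_of_pos (by linarith)]; linarith)).le
  constructor <;> positivity

end defect

/-! ### Expansions of the side angle and the perimeter. -/

section sequences

variable {α : Type*} {q : α → ℕ} {t η : α → ℝ}

lemma bdd_defect_div (t0 : ∀ a, 0 < t a) (η0 : ∀ a, 0 < η a) (h : ∀ a, η a ≤ 18 * t a ^ 4) :
    ∃ κ : α → ℝ, Bdd κ ∧ ∀ a, η a = κ a * t a ^ 4 := by
  obtain ⟨κ, hκ, e⟩ := Bdd.exists_eq_mul (f := η) (g := fun a => t a ^ 4) 18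
    (fun a => pow_pos (t0 a) 4) (fun a => by rw [abs_of_pos (η0 a)]; exact h a)
  exact ⟨κ, hκ, fun a => by rw [e]; ring⟩

theorem defect_expansion_B
    (H : ∀ a, IsPatternAngle BStep (4 * q a + 4) (4 * q a + 3) (t a))
    (hη : ∀ a, η a = π / 2 - 2 * ((4 * q a + 4 : ℕ) : ℝ) * t a) :
    ∃ κ k, Bdd κ ∧ Bdd k ∧ (∀ a, η a = κ a * t a ^ 4) ∧
      ∀ a, κ a = 1 / 2 - t a / 2 + 11 / 12 * t a ^ 2 - 35 / 24 * t a ^ 3 + t a ^ 4 * k a := by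
  choose t0 t1 η0 η1 using fun a => defect_bounds (H a) (hη a)
  choose E hE he using fun a => defect_B (H a) (hη a)
  have hb : ∀ a, η a ≤ 18 * t a ^ 4 := fun a => by
    obtain ⟨h1, h2⟩ := defect_nonneg (η := η a) (t0 a) (t1 a)
    exact defect_le_aux (t0 a) (t1 a) (η0 a) (η1 a) (by rw [hE]; exact h1)
      (by rw [hE]; exact le_add_of_nonneg_right h2) (he a)
  obtain ⟨κ, hκ, e⟩ := bdd_defect_div t0 η0 hb
  obtain ⟨k, hk, ek⟩ :=
    expansion_B t0 t1 η0 (fun a => by linarith [η1 a, t0 a]) hκ e hE he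
  exact ⟨κ, k, hκ, hk, e, ek⟩

theorem defect_expansion_M
    (H : ∀ a, IsPatternAngle MStep (4 * q a + 4) (4 * q a + 4) (t a))
    (hη : ∀ a, η a = π / 2 - 2 * ((4 * q a + 4 : ℕ) : ℝ) * t a) :
    ∃ κ k, Bdd κ ∧ Bdd k ∧ (∀ a, η a = κ a * t a ^ 4) ∧ ∀ a, κ a = 3 / 2 + t a * k a := by
  choose t0 t1 η0 η1 using fun a => defect_bounds (H a) (hη a)
  choose E hE he using fun a => defect_M (H a) (hη a)
  have hb : ∀ a, η a ≤ 18 * t a ^ 4 := fun a => by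
    obtain ⟨h1, h2⟩ := defect_nonneg (η := η a) (t0 a) (t1 a)
    exact defect_le_aux (t0 a) (t1 a) (η0 a) (η1 a) (by rw [hE]; linarith) (hE a).le (he a)
  obtain ⟨κ, hκ, e⟩ := bdd_defect_div t0 η0 hb
  obtain ⟨k, hk, ek⟩ :=
    expansion_M t0 t1 η0 (fun a => by linarith [η1 a, t0 a]) hκ e hE he
  exact ⟨κ, k, hκ, hk, e, ek⟩

/-- The ratio of `t` and `z = π / n`. -/
lemma exists_ratio {z κ : α → ℝ} (z0 : ∀ a, 0 < z a) (z1 : ∀ a, z a ≤ 1) (t0 : ∀ a, 0 < t a)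
    (tz : ∀ a, t a = z a - 2 / π * z a * η a) (η0 : ∀ a, 0 < η a) (hκ : Bdd κ)
    (e : ∀ a, η a = κ a * t a ^ 4) :
    Bdd z ∧ ∃ y w, Bdd y ∧ Bdd w ∧ (∀ a, 0 < y a ∧ y a ≤ 1) ∧ (∀ a, t a = z a * y a) ∧
      (∀ a, w a = 2 / π * κ a * y a ^ 4) ∧ ∀ a, y a = 1 - z a ^ 4 * w a := by
  have hy : ∀ a, 0 < t a / z a ∧ t a / z a ≤ 1 := fun a => by
    refine ⟨div_pos (t0 a) (z0 a), (div_le_one (z0 a)).2 ?_⟩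
    have := mul_pos (mul_pos (div_pos two_pos pi_pos) (z0 a)) (η0 a)
    linarith [tz a]
  have hyb : Bdd fun a => t a / z a := Bdd.of_le 1 fun a => by
    rw [abs_of_pos (hy a).1]; exact (hy a).2
  have ht : ∀ a, t a = z a * (t a / z a) := fun a => by
    have := (z0 a).ne'
    field_simp
  refine ⟨Bdd.of_le 1 fun a => by rw [abs_of_pos (z0 a)]; exact z1 a, fun a => t a / z a,
    fun a => 2 / π * κ a * (t a / z a) ^ 4, hyb, by fun_prop, hy, ht, fun a => rfl, fun a => ?_⟩
  refine mul_left_cancel₀ (z0 a).ne' ?_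
  have h := ht a
  set y := t a / z a
  have h1 := tz a
  rw [e, h] at h1
  linear_combination h1

/-- Since t/z = 1 - O(z⁴), replacing t by z = π/n in the expansion of κ has relative cost z⁴. With
the prefactor z · z⁴ the error is of order z⁹, so the coefficients carry over unchanged. -/
theorem angle_expansion_B {z κ k : α → ℝ} (z0 : ∀ a, 0 < z a) (z1 : ∀ a, z a ≤ 1)
    (t0 : ∀ a, 0 < t a) (tz : ∀ a, t a = z a - 2 / π * z a * η a) (η0 : ∀ a, 0 < η a) (hκ : Bdd κ)
    (e : ∀ a, η a = κ a * t a ^ 4) (hk : Bdd k)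
    (ek : ∀ a, κ a = 1 / 2 - t a / 2 + 11 / 12 * t a ^ 2 - 35 / 24 * t a ^ 3 + t a ^ 4 * k a) :
    ∃ r, Bdd r ∧ ∀ a, t a - (z a - 2 / π * z a * (z a ^ 4 / 2 - z a ^ 5 / 2 + 11 / 12 * z a ^ 6
      - 35 / 24 * z a ^ 7)) = z a ^ 9 * r a := by
  obtain ⟨hz, y, w, hy, hw, -, ht, -, ey⟩ := exists_ratio z0 z1 t0 tz η0 hκ e
  refine ⟨fun a => -(2 / π) * (-(w a * (1 + y a + y a ^ 2 + y a ^ 3)) / 2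
    + z a * w a * (1 + y a + y a ^ 2 + y a ^ 3 + y a ^ 4) / 2
    - 11 / 12 * z a ^ 2 * w a * (1 + y a + y a ^ 2 + y a ^ 3 + y a ^ 4 + y a ^ 5)
    + 35 / 24 * z a ^ 3 * w a * (1 + y a + y a ^ 2 + y a ^ 3 + y a ^ 4 + y a ^ 5 + y a ^ 6)
    + y a ^ 8 * k a), by fun_prop, fun a => ?_⟩
  have h := tz a
  rw [e, ek] at h
  have h4 : y a ^ 4 - 1 = -(z a ^ 4 * w a) * (1 + y a + y a ^ 2 + y a ^ 3) := by
    linear_combination (1 + y a + y a ^ 2 + y a ^ 3) * ey a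
  have h5 : y a ^ 5 - 1 = -(z a ^ 4 * w a) * (1 + y a + y a ^ 2 + y a ^ 3 + y a ^ 4) := by
    linear_combination (1 + y a + y a ^ 2 + y a ^ 3 + y a ^ 4) * ey a
  have h6 : y a ^ 6 - 1 = -(z a ^ 4 * w a) * (1 + y a + y a ^ 2 + y a ^ 3 + y a ^ 4 + y a ^ 5) := by
    linear_combination (1 + y a + y a ^ 2 + y a ^ 3 + y a ^ 4 + y a ^ 5) * ey a
  have h7 : y a ^ 7 - 1 =
      -(z a ^ 4 * w a) * (1 + y a + y a ^ 2 + y a ^ 3 + y a ^ 4 + y a ^ 5 + y a ^ 6) := by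
    linear_combination (1 + y a + y a ^ 2 + y a ^ 3 + y a ^ 4 + y a ^ 5 + y a ^ 6) * ey a
  nth_rewrite 1 [h]
  rw [ht]
  linear_combination -(2 / π) * z a * (z a ^ 4 / 2 * h4 - z a ^ 5 / 2 * h5
    + 11 / 12 * z a ^ 6 * h6 - 35 / 24 * z a ^ 7 * h7)

/-- The difference of the perimeters belonging to the side angles `z = π / n` and `t`. -/
theorem perimeter_expansion {z κ : α → ℝ} (z0 : ∀ a, 0 < z a) (z1 : ∀ a, z a ≤ 1)
    (t0 : ∀ a, 0 < t a) (tz : ∀ a, t a = z a - 2 / π * z a * η a) (η0 : ∀ a, 0 < η a)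
    (η1 : ∀ a, η a ≤ 1) (hκ : Bdd κ) (e : ∀ a, η a = κ a * t a ^ 4) {k : α → ℝ} {c : ℝ}
    (hk : Bdd k) (ek : ∀ a, κ a = c + t a * k a) :
    ∃ r, Bdd r ∧ ∀ a, 2 * (π / z a) * sin (z a / 2) - π / z a * (2 * sin (t a / 2)) =
      2 * c * z a ^ 4 + z a ^ 5 * r a := by
  obtain ⟨hz, y, w, hy, hw, hy', ht, -, ey⟩ := exists_ratio z0 z1 t0 tz η0 hκ e
  have hpi := pi_gt_three
  have hpi0 := pi_pos
  have hη : Bdd η := Bdd.of_le 1 fun a => by rw [abs_of_pos (η0 a)]; exact η1 a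
  obtain ⟨b, hb, eb⟩ := Bdd.exists_sin_eq (f := fun a => z a * η a / (2 * π))
    (fun a => by have := z0 a; have := η0 a; positivity)
    (fun a => by
      rw [div_le_one (by positivity)]
      have := mul_le_mul (z1 a) (η1 a) (η0 a).le zero_le_one
      linarith)
  obtain ⟨g, hg, eg⟩ := Bdd.exists_cos_eq (f := fun a => z a * (1 + y a) / 4)
    (fun a => by have := z0 a; have := (hy' a).1; positivity)
    (fun a => by
      have := mul_le_mul (z1 a) (show 1 + y a ≤ 2 by linarith [(hy' a).2])
        (by linarith [(hy' a).1]) zero_le_one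
      linarith)
  obtain ⟨B, hB, eB⟩ : ∃ B, Bdd B ∧ ∀ a, sin (z a * η a / (2 * π)) =
      z a * η a / (2 * π) * (1 + z a * B a) :=
    ⟨fun a => z a * (η a / (2 * π)) ^ 2 * (-1 / 6 + (z a * η a / (2 * π)) ^ 2 * b a),
      by fun_prop, fun a => by rw [eb]; ring⟩
  obtain ⟨G, hG, eG⟩ : ∃ G, Bdd G ∧ ∀ a, cos (z a * (1 + y a) / 4) = 1 + z a * G a :=
    ⟨fun a => z a * ((1 + y a) / 4) ^ 2 * (-1 / 2 + (z a * (1 + y a) / 4) ^ 2 * g a),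
      by fun_prop, fun a => by rw [eg]; ring⟩
  obtain ⟨W, hW, eW⟩ : ∃ W, Bdd W ∧ ∀ a, η a = c * z a ^ 4 + z a ^ 5 * W a := by
    refine ⟨fun a => -(c * (z a ^ 3 * w a) * (1 + y a + y a ^ 2 + y a ^ 3)) + y a ^ 5 * k a,
      by fun_prop, fun a => ?_⟩
    have h4 : y a ^ 4 - 1 = -(z a ^ 4 * w a) * (1 + y a + y a ^ 2 + y a ^ 3) := by
      linear_combination (1 + y a + y a ^ 2 + y a ^ 3) * ey a
    rw [e, ek, ht]
    linear_combination c * z a ^ 4 * h4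
  refine ⟨fun a => 2 * W a + 2 * (c + z a * W a) * (B a + G a + z a * B a * G a), by fun_prop,
    fun a => ?_⟩
  -- Here (z - t)/4 = zη/(2π), so after multiplication by 2π/z the sine factor gives 2η to leading
  -- order.
  have hs : sin (z a / 2) - sin (t a / 2) =
      2 * sin (z a * η a / (2 * π)) * cos (z a * (1 + y a) / 4) := by
    rw [sin_sub_sin]
    congr 2
    · congr 1
      rw [tz]
      field_simp
      ring
    · rw [ht]; ring
  have h0 := (z0 a).ne'
  calc 2 * (π / z a) * sin (z a / 2) - π / z a * (2 * sin (t a / 2))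
      = 2 * (π / z a) * (sin (z a / 2) - sin (t a / 2)) := by ring
    _ = 2 * η a * (1 + z a * B a) * (1 + z a * G a) := by
      rw [hs, eB, eG]
      field_simp
    _ = _ := by rw [eW]; ring

end sequences

/-! ### From bounded remainders to the theorem. -/

lemma isBigO_of_bdd {f : ℕ → ℝ} {k : ℕ} {r : {s : ℕ // 4 ≤ s} → ℝ} (hr : Bdd r)
    (e : ∀ a : {s : ℕ // 4 ≤ s}, f a = (π / 2 ^ (a : ℕ)) ^ k * r a) :
    f =O[atTop] fun s : ℕ => 1 / ((2 : ℝ) ^ s) ^ k := by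
  obtain ⟨C, hC⟩ := hr
  refine IsBigO.of_bound (π ^ k * C) (eventually_atTop.2 ⟨4, fun s hs => ?_⟩)
  have := mul_le_mul_of_nonneg_left (hC ⟨s, hs⟩)
    (show 0 ≤ π ^ k / ((2 : ℝ) ^ s) ^ k by positivity)
  have hp : 0 ≤ (π / (2 : ℝ) ^ s) ^ k := by positivity
  rw [e ⟨s, hs⟩, Real.norm_eq_abs, Real.norm_eq_abs, abs_mul, abs_of_nonneg hp,
    abs_of_nonneg (show 0 ≤ 1 / ((2 : ℝ) ^ s) ^ k by positivity), div_pow]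
  calc _ ≤ _ := this
    _ = _ := by ring

lemma two_pow_eq {s : ℕ} (hs : 4 ≤ s) : 2 ^ s = 16 * (2 ^ (s - 4) - 1 + 1) := by
  have : 0 < 2 ^ (s - 4) := by positivity
  rw [Nat.sub_add_cancel this, show (16 : ℕ) = 2 ^ 4 by norm_num, ← pow_add,
    Nat.add_sub_cancel' hs]

/-- The relation of `t`, `π / n` and the defect. -/
lemma angle_eq_sub {s : ℕ} (hs : 4 ≤ s) {t η : ℝ}
    (hη : η = π / 2 - 2 * ((4 * (2 ^ (s - 4) - 1) + 4 : ℕ) : ℝ) * t) :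
    t = π / 2 ^ s - 2 / π * (π / 2 ^ s) * η := by
  have h : ((2 : ℝ) ^ s) = 4 * ((4 * (2 ^ (s - 4) - 1) + 4 : ℕ) : ℝ) := by
    have := two_pow_eq hs
    have h2 : 2 ^ s = 4 * (4 * (2 ^ (s - 4) - 1) + 4) := by omega
    exact_mod_cast h2
  have hp : (0 : ℝ) < 2 ^ s := by positivity
  have h3 : η = π / 2 - 2 ^ s / 2 * t := by rw [hη, h]; ring
  have := pi_pos.ne'
  rw [h3]
  field_simp
  ring

theorem theorem1 :
    (∀ s : ℕ, 4 ≤ s → ∃ M : Polygon Plane (2 ^ s), IsMossinghoffPolygon M) ∧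
    ∃ (t₀ : ℕ → ℝ) (B : ∀ s : ℕ, Polygon Plane (2 ^ s)),
      (∀ s : ℕ, 4 ≤ s →
        t₀ s ∈ Set.Ioo 0 (π / (2 : ℝ) ^ s) ∧
        SideAngleEquation (2 ^ s) (t₀ s) ∧
        IsBPolygon (t₀ s) (B s)) ∧
      (fun s : ℕ => t₀ s -
          (π / ((2 : ℝ) ^ s) - π ^ 4 / ((2 : ℝ) ^ s) ^ 5 + π ^ 5 / ((2 : ℝ) ^ s) ^ 6
            - 11 * π ^ 6 / (6 * ((2 : ℝ) ^ s) ^ 7) + 35 * π ^ 7 / (12 * ((2 : ℝ) ^ s) ^ 8)))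
        =O[atTop] (fun s : ℕ => 1 / ((2 : ℝ) ^ s) ^ 9) ∧
      (fun s : ℕ => 2 * (2 : ℝ) ^ s * sin (π / (2 * (2 : ℝ) ^ s)) - (B s).perimeter
          - π ^ 4 / ((2 : ℝ) ^ s) ^ 4)
        =O[atTop] (fun s : ℕ => 1 / ((2 : ℝ) ^ s) ^ 5) ∧
      ∀ M : ∀ s : ℕ, Polygon Plane (2 ^ s), (∀ s : ℕ, 4 ≤ s → IsMossinghoffPolygon (M s)) →
        (fun s : ℕ => (B s).perimeter - (M s).perimeter - 2 * π ^ 4 / ((2 : ℝ) ^ s) ^ 4)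
          =O[atTop] (fun s : ℕ => 1 / ((2 : ℝ) ^ s) ^ 5) := by
  refine ⟨fun s hs => exists_isMossinghoffPolygon (two_pow_eq hs), ?_⟩
  choose T HT using exists_BAngle
  -- Chosen so that 2^s = 16(q + 1). Indexing by the admissible `s` alone makes every estimate valid
  -- at every index, as `Bdd` demands.
  let q : {s : ℕ // 4 ≤ s} → ℕ := fun a => 2 ^ ((a : ℕ) - 4) - 1
  let z : {s : ℕ // 4 ≤ s} → ℝ := fun a => π / 2 ^ (a : ℕ)
  have z0 : ∀ a, 0 < z a := fun a => by have := pi_pos; positivity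
  have z1 : ∀ a, z a ≤ 1 := fun a => by
    rw [div_le_one (by positivity)]
    calc π ≤ (2 : ℝ) ^ 4 := by linarith [pi_lt_d2]
      _ ≤ 2 ^ (a : ℕ) := pow_le_pow_right₀ one_le_two a.2
  let defect : ({s : ℕ // 4 ≤ s} → ℝ) → {s : ℕ // 4 ≤ s} → ℝ :=
    fun t a => π / 2 - 2 * ((4 * q a + 4 : ℕ) : ℝ) * t a
  have tz : ∀ t a, t a = z a - 2 / π * z a * defect t a := fun t a => angle_eq_sub a.2 rfl
  have zn : ∀ a, π / z a = 2 ^ (a : ℕ) := fun a => div_div_cancel₀ pi_pos.ne'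
  let tB : {s : ℕ // 4 ≤ s} → ℝ := fun a => T (q a)
  have HB : ∀ a, IsPatternAngle BStep (4 * q a + 4) (4 * q a + 3) (tB a) := fun a => HT (q a)
  choose t0 t1 η0 η1 using fun a => defect_bounds (η := defect tB a) (HB a) rfl
  obtain ⟨κ, k, hκ, hk, e, ek⟩ := defect_expansion_B (η := defect tB) HB fun a => rfl
  have htb : Bdd tB := Bdd.of_le 1 fun a => by rw [abs_of_pos (t0 a)]; linarith [t1 a]
  obtain ⟨r, hr, er⟩ := perimeter_expansion z0 z1 t0 (tz tB) η0
    (fun a => by linarith [η1 a, t1 a]) hκ e (c := 1 / 2)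
    (k := fun a => -1 / 2 + 11 / 12 * tB a - 35 / 24 * tB a ^ 2 + tB a ^ 3 * k a) (by fun_prop)
    (fun a => by rw [ek]; ring)
  have per : ∀ a : {s : ℕ // 4 ≤ s}, (patternPolygon BStep (4 * q a + 4) (4 * q a + 3) (tB a)
      (2 ^ (a : ℕ))).perimeter = π / z a * (2 * sin (tB a / 2)) := fun a => by
    rw [perimeter_BPolygon (two_pow_eq a.2) (HB a), zn]
    push_cast
    rfl
  refine ⟨fun s => T (2 ^ (s - 4) - 1), fun s => patternPolygon BStep
    (4 * (2 ^ (s - 4) - 1) + 4) (4 * (2 ^ (s - 4) - 1) + 3) (T (2 ^ (s - 4) - 1)) (2 ^ s),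
    fun s hs => ⟨⟨(HT _).pos, ?_⟩, sideAngleEquation (two_pow_eq hs) (HT _),
      isBPolygon (two_pow_eq hs) (HT _)⟩, ?_, ?_, fun M hM => ?_⟩
  · have h1 := tz tB ⟨s, hs⟩
    have h2 := mul_pos (mul_pos (div_pos two_pos pi_pos) (z0 ⟨s, hs⟩)) (η0 ⟨s, hs⟩)
    show tB ⟨s, hs⟩ < z ⟨s, hs⟩
    linarith
  · obtain ⟨w, hw, ew⟩ := angle_expansion_B z0 z1 t0 (tz tB) η0 hκ e hk ek
    refine isBigO_of_bdd hw fun a => ?_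
    show _ = z a ^ 9 * w a
    rw [← ew a]
    show tB a - _ = tB a - _
    congr 1
    have := pi_pos.ne'
    simp only [z]
    field_simp
    ring
  · refine isBigO_of_bdd hr fun a => ?_
    have h := er a
    have e1 : π / (2 * (2 : ℝ) ^ (a : ℕ)) = z a / 2 := by simp only [z]; field_simp
    have e2 : π ^ 4 / ((2 : ℝ) ^ (a : ℕ)) ^ 4 = z a ^ 4 := by simp only [z]; rw [div_pow]
    show 2 * (2 : ℝ) ^ (a : ℕ) * sin (π / (2 * (2 : ℝ) ^ (a : ℕ))) - (patternPolygon BStep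
      (4 * q a + 4) (4 * q a + 3) (tB a) (2 ^ (a : ℕ))).perimeter
      - π ^ 4 / ((2 : ℝ) ^ (a : ℕ)) ^ 4 = z a ^ 5 * r a
    rw [e1, e2, per, ← zn]
    linarith
  -- The given polygons may come with any admissible angles; the expansion of the defect uses only
  -- the side equation. Subtracting the two deficits, 3z⁴ for M and z⁴ for B, leaves 2z⁴.
  · choose tM HM pM using fun a : {s : ℕ // 4 ≤ s} => (hM a a.2).exists_angle (two_pow_eq a.2)
    choose t0' t1' η0' η1' using fun a => defect_bounds (q := q a) (η := defect tM a) (HM a) rfl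
    obtain ⟨κ', k', hκ', hk', e', ek'⟩ :=
      defect_expansion_M (q := q) (η := defect tM) HM fun a => rfl
    obtain ⟨r', hr', er'⟩ := perimeter_expansion z0 z1 t0' (tz tM) η0'
      (fun a => by linarith [η1' a, t1' a]) hκ' e' hk' ek'
    refine isBigO_of_bdd (hr'.sub hr) fun a => ?_
    have h := er a
    have h' := er' a
    have e2 : 2 * π ^ 4 / ((2 : ℝ) ^ (a : ℕ)) ^ 4 = 2 * z a ^ 4 := by
      simp only [z]; rw [div_pow]; ring
    have p := pM a
    push_cast at p
    rw [← zn a] at p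
    show (patternPolygon BStep (4 * q a + 4) (4 * q a + 3) (tB a) (2 ^ (a : ℕ))).perimeter
      - (M a).perimeter - 2 * π ^ 4 / ((2 : ℝ) ^ (a : ℕ)) ^ 4 = z a ^ 5 * (r' a - r a)
    rw [e2, per, p]
    linarith
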